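/- Let $H$ be a discrete Schrödinger operator $$[H\psi](n)=\psi(n+1)+\psi(n-1)+V(n)\psi(n)$$ with a real potential $V$, acting on $\ell^2(\mathbb Z)$ or on $\ell^2(\mathbb Z_+)$, $\mathbb Z_+=\{1,2,\dots\}$, in the latter case with the Dirichlet boundary condition $\psi(0)=0$ (if $V$ is unbounded, $H$ is taken on its maximal domain, where it is self-adjoint). Let $\mu$ be the spectral measure of $H$ and $\delta_1$, and let $$F(z)=\langle (H-z)^{-1}\delta_1,\delta_1\rangle=\int_{\mathbb R}\frac{d\mu(x)}{x-z}$$ be its Borel transform. For $T>0$ and $p>0$ put $$a(n,T)=\frac2T\int_0^\infty e^{-2t/T}\,|\langle e^{-itH}\delta_1,\delta_n\rangle|^2\,dt,\qquad \langle|X|^p_{\delta_1}\rangle(T)=\sum_n|n|^p\,a(n,T),$$ and for $\Delta\subseteq\mathbb R$ and $\nu>0$ put $$I(\Delta,\nu)=\nu\int_\Delta(\operatorname{Im}F(E+i\nu))^2\,dE,\qquad \Delta_\nu=\{E\in\mathbb R:\operatorname{dist}(E,\Delta)<\nu\}.$$ **Theorem.** Let $p>0$. There is a constant $C_p>0$,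 depending only on $p$, such that the following holds for every such operator $H$. Let $A=A(T)\subseteq\mathbb R$ be Borel sets, possibly depending on $T$, and let $g_p(T)$ be a function of $T$. For every $T>0$ with $\mu(A)>0$, $g_p(T)>0$ and $$\langle|X|^p_{\delta_1}\rangle(T)\ \ge\ g_p(T)\,I(A_{2\varepsilon},\varepsilon),\qquad \varepsilon=\frac1T,$$ one has $$\langle|X|^p_{\delta_1}\rangle(T)\ \ge\ C_p\,g_p(T)^{p/(p+1)}\,\mu(A)^{(1+2p)/(p+1)}.$$ In particular, if the Borel set $A$ does not depend on $T$ and $\mu(A)>0$, then there is a constant $C>0$, independent of $T$ and of $g_p$ (but depending on $p$, $H$ and $A$), such that for every $T>0$ for which $g_p(T)>0$ and the above hypothesis holds, $$\langle|X|^p_{\delta_1}\rangle(T)\ \ge\ C\,g_p(T)^{p/(p+1)}.$$ -/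

import Mathlib

open MeasureTheory Filter Topology

namespace Schrodinger

/-- The two configuration spaces: the whole line `ℤ` and the half-line `{1, 2, …}`. -/
inductive Domain
  | wholeLine
  | halfLine

/-- The set of sites, as a subset of `ℤ`. -/
def Domain.sites : Domain → Set ℤ
  | .wholeLine => Set.univ
  | .halfLine => Set.Ici 1

theorem Domain.one_mem (d : Domain) : (1 : ℤ) ∈ d.sites := by
  cases d <;> simp [Domain.sites]

/-- The site `1`. -/
def Domain.one (d : Domain) : d.sites := ⟨1, d.one_mem⟩

noncomputable section

/-- The Hilbert space `ℓ²` over the sites. -/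
abbrev Domain.ell2 (d : Domain) := lp (fun _ : d.sites => ℂ) 2

/-- The unit vector `δ₁`. -/
def delta (d : Domain) : d.ell2 := lp.single 2 d.one 1

open Classical in
/-- The value of `f` at an integer, with the value `0` off the sites. On the half-line this is the
Dirichlet boundary condition. -/
def zeroExt {d : Domain} (f : d.sites → ℂ) (n : ℤ) : ℂ := if h : n ∈ d.sites then f ⟨n, h⟩ else 0

/-- The difference expression `f(n + 1) + f(n - 1) + V(n) f(n)`. -/
def expr {d : Domain} (V : d.sites → ℝ) (f : d.sites → ℂ) : d.sites → ℂ :=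
  fun n => zeroExt f (n + 1) + zeroExt f (n - 1) + (V n : ℂ) * f n

theorem zeroExt_add {d : Domain} (f g : d.sites → ℂ) (n : ℤ) :
    zeroExt (f + g) n = zeroExt f n + zeroExt g n := by
  unfold zeroExt; split_ifs <;> simp

theorem zeroExt_smul {d : Domain} (c : ℂ) (f : d.sites → ℂ) (n : ℤ) :
    zeroExt (c • f) n = c * zeroExt f n := by
  unfold zeroExt; split_ifs <;> simp

theorem expr_add {d : Domain} (V : d.sites → ℝ) (f g : d.sites → ℂ) :
    expr V (f + g) = expr V f + expr V g := by
  ext n; simp only [expr, zeroExt_add, Pi.add_apply]; ring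

theorem expr_smul {d : Domain} (V : d.sites → ℝ) (c : ℂ) (f : d.sites → ℂ) :
    expr V (c • f) = c • expr V f := by
  ext n; simp only [expr, zeroExt_smul, Pi.smul_apply, smul_eq_mul]; ring

/-- The discrete Schrödinger operator `H` with potential `V`, on its maximal domain
`{ψ ∈ ℓ² | Hψ ∈ ℓ²}` (all of `ℓ²` if `V` is bounded), where it is self-adjoint for every real
potential. -/
def hamiltonian {d : Domain} (V : d.sites → ℝ) : d.ell2 →ₗ.[ℂ] d.ell2 where
  domain :=
    { carrier := {ψ | Memℓp (expr V ψ) 2}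
      add_mem' := by
        intro a b ha hb
        simp only [Set.mem_ofPred_eq, lp.coeFn_add, expr_add] at *
        exact ha.add hb
      zero_mem' := by
        have : expr V (0 : d.sites → ℂ) = 0 := by
          simpa using expr_smul V 0 (0 : d.sites → ℂ)
        simp only [Set.mem_ofPred_eq, lp.coeFn_zero, this]
        exact zero_memℓp
      smul_mem' := by
        intro c a ha
        simp only [Set.mem_ofPred_eq, lp.coeFn_smul, expr_smul] at *
        exact ha.const_smul c }
  toFun :=
    { toFun := fun ψ => ⟨expr V ψ.1, ψ.2⟩
      map_add' := by
        intro a b; ext n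
        exact congrFun (expr_add V a.1 b.1) n
      map_smul' := by
        intro c a; ext n
        exact congrFun (expr_smul V c a.1) n }

theorem mem_domain_iff {d : Domain} {V : d.sites → ℝ} {ψ : d.ell2} :
    ψ ∈ (hamiltonian V).domain ↔ Memℓp (expr V ψ) 2 := Iff.rfl

theorem hamiltonian_apply {d : Domain} (V : d.sites → ℝ) (ψ : (hamiltonian V).domain)
    (n : d.sites) : (hamiltonian V ψ : d.ell2) n = expr V (ψ : d.ell2) n := rfl

theorem zeroExt_coe {d : Domain} (f : d.sites → ℂ) (n : d.sites) : zeroExt f n = f n := by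
  simp [zeroExt]

theorem zeroExt_of_notMem {d : Domain} (f : d.sites → ℂ) {n : ℤ} (h : n ∉ d.sites) :
    zeroExt f n = 0 := by
  simp [zeroExt, h]

theorem summable_zeroExt_sq {d : Domain} (f : d.ell2) :
    Summable fun n : ℤ => ‖zeroExt f n‖ ^ 2 := by
  have h1 : Summable fun n : d.sites => ‖f n‖ ^ 2 := by
    simpa using (lp.memℓp f).summable (by simp)
  have h2 : (fun n : d.sites => ‖f n‖ ^ 2) =
      (fun n : ℤ => ‖zeroExt f n‖ ^ 2) ∘ ((↑) : d.sites → ℤ) := by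
    ext n; simp [zeroExt_coe]
  rw [h2] at h1
  have hsupp : Function.support (fun n : ℤ => ‖zeroExt f n‖ ^ 2) ⊆ d.sites := ?_
  · exact ((hasSum_subtype_iff_of_support_subset hsupp).1 h1.hasSum).summable
  intro n hn
  by_contra h
  exact hn (by simp [zeroExt_of_notMem _ h])

theorem summable_star_mul {a b : ℤ → ℂ} (ha : Summable fun n => ‖a n‖ ^ 2)
    (hb : Summable fun n => ‖b n‖ ^ 2) : Summable fun n => star (a n) * b n := by
  have hab : Summable fun n => ‖a n‖ ^ 2 + ‖b n‖ ^ 2 := ha.add hb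
  refine Summable.of_norm_bounded (g := fun n => ‖a n‖ ^ 2 + ‖b n‖ ^ 2) hab fun n => ?_
  rw [norm_mul, norm_star]
  nlinarith [sq_nonneg (‖a n‖ - ‖b n‖), sq_nonneg (‖a n‖), sq_nonneg (‖b n‖)]

theorem hasSum_telescope {w : ℤ → ℂ} (hw : Summable w) :
    HasSum (fun n => w n - w (n - 1)) 0 := by
  have h2 : HasSum (w ∘ Equiv.subRight (1 : ℤ)) (∑' n, w n) :=
    (Equiv.subRight (1 : ℤ)).hasSum_iff.2 hw.hasSum
  have h3 := hw.hasSum.sub h2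
  rw [sub_self] at h3
  exact h3

/-- The operator is symmetric on its maximal domain. -/
theorem hamiltonian_symm {d : Domain} (V : d.sites → ℝ) (φ ψ : (hamiltonian V).domain) :
    inner ℂ (hamiltonian V φ) (ψ : d.ell2) = inner ℂ (φ : d.ell2) (hamiltonian V ψ) := by
  have hs := (lp.hasSum_inner (𝕜 := ℂ) (hamiltonian V φ) (ψ : d.ell2)).sub
    (lp.hasSum_inner (𝕜 := ℂ) (φ : d.ell2) (hamiltonian V ψ))
  set f : ℤ → ℂ := zeroExt (φ : d.ell2) with hf
  set g : ℤ → ℂ := zeroExt (ψ : d.ell2) with hg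
  let w : ℤ → ℂ := fun n => star (f (n + 1)) * g n - star (f n) * g (n + 1)
  have sf := summable_zeroExt_sq (φ : d.ell2)
  have sg := summable_zeroExt_sq (ψ : d.ell2)
  have sf' := (Equiv.addRight (1 : ℤ)).summable_iff.2 sf
  have sg' := (Equiv.addRight (1 : ℤ)).summable_iff.2 sg
  have hw : Summable w := (summable_star_mul sf' sg).sub (summable_star_mul sf sg')
  have hw1 := hasSum_telescope hw
  have hw2 : HasSum ((fun n => w n - w (n - 1)) ∘ ((↑) : d.sites → ℤ)) 0 := by
    have hsupp : Function.support (fun n => w n - w (n - 1)) ⊆ d.sites := ?_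
    · exact (hasSum_subtype_iff_of_support_subset hsupp).2 hw1
    intro n hn
    by_contra h
    have h1 : f n = 0 := zeroExt_of_notMem _ h
    have h2 : g n = 0 := zeroExt_of_notMem _ h
    exact hn (by simp [w, h1, h2])
  have e : (fun n : d.sites => inner ℂ ((hamiltonian V φ : d.ell2) n) ((ψ : d.ell2) n) -
      inner ℂ ((φ : d.ell2) n) ((hamiltonian V ψ : d.ell2) n)) =
      (fun n => w n - w (n - 1)) ∘ ((↑) : d.sites → ℤ) := by
    ext n
    have h1 : f n = (φ : d.ell2) n := zeroExt_coe _ n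
    have h2 : g n = (ψ : d.ell2) n := zeroExt_coe _ n
    simp only [hamiltonian_apply, expr, RCLike.inner_apply, Function.comp, w, ← hf, ← hg, ← h1,
      ← h2, map_add, map_mul, Complex.conj_ofReal, RCLike.star_def, sub_add_cancel]
    ring
  rw [e] at hs
  exact sub_eq_zero.1 (hs.unique hw2)

/-- `ψ` solves the Schrödinger equation `i ψ' = H ψ` with `ψ(0) = δ₁`, that is,
`ψ(t) = e^{-itH} δ₁`. -/
def IsEvolution {d : Domain} (V : d.sites → ℝ) (ψ : ℝ → d.ell2) : Prop :=
  ψ 0 = delta d ∧ ∀ t : ℝ, ∃ h : ψ t ∈ (hamiltonian V).domain,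
    HasDerivAt ψ (-Complex.I • hamiltonian V ⟨ψ t, h⟩) t

theorem IsEvolution.unique {d : Domain} {V : d.sites → ℝ} {ψ χ : ℝ → d.ell2}
    (hψ : IsEvolution V ψ) (hχ : IsEvolution V χ) : ψ = χ := by
  have hder : ∀ t, HasDerivAt (fun t => inner ℂ (ψ t - χ t) (ψ t - χ t)) 0 t := by
    intro t
    obtain ⟨h1, d1⟩ := hψ.2 t
    obtain ⟨h2, d2⟩ := hχ.2 t
    have hd : HasDerivAt (fun t => ψ t - χ t) _ t := d1.sub d2
    have h := hd.inner ℂ hd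
    refine h.congr_deriv ?_
    have e : -Complex.I • hamiltonian V ⟨ψ t, h1⟩ - -Complex.I • hamiltonian V ⟨χ t, h2⟩ =
        -Complex.I • hamiltonian V (⟨ψ t, h1⟩ - ⟨χ t, h2⟩) := by
      rw [(hamiltonian V).map_sub, smul_sub]
    have s := hamiltonian_symm V (⟨ψ t, h1⟩ - ⟨χ t, h2⟩) (⟨ψ t, h1⟩ - ⟨χ t, h2⟩)
    rw [e, inner_smul_left, inner_smul_right]
    simp only [AddSubgroupClass.coe_sub] at s ⊢
    rw [s]
    simp only [map_neg, Complex.conj_I]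
    ring
  funext t
  have hc := is_const_of_deriv_eq_zero (fun t => (hder t).differentiableAt)
    (fun t => (hder t).deriv) t 0
  simp only [hψ.1, hχ.1, sub_self, inner_zero_left] at hc
  exact sub_eq_zero.1 (inner_self_eq_zero.1 hc)

/-- Spectral resolution of a Hermitian matrix at a basis vector: `U h = h(A) e_o`. -/
theorem finite_spectral {ι : Type*} [Fintype ι] [DecidableEq ι] (A : Matrix ι ι ℂ)
    (hA : A.IsHermitian) (o : ι) :
    ∃ (ν : Measure ℝ) (U : (ℝ → ℂ) →ₗ[ℂ] (ι → ℂ)), IsProbabilityMeasure ν ∧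
      U 1 = Pi.single o 1 ∧ (∀ h, A.mulVec (U h) = U (fun x => (x : ℂ) * h x)) ∧
      (∀ h, ∑ n, ‖U h n‖ ^ 2 = ∫ x, ‖h x‖ ^ 2 ∂ν) ∧ (∀ h, U h o = ∫ x, h x ∂ν) ∧
      (∀ h : ℝ → ℝ, Integrable h ν) := by
  set b := hA.eigenvectorBasis with hb
  set lam := hA.eigenvalues with hlam
  let e : EuclideanSpace ℂ ι := EuclideanSpace.single o 1
  have hbo : ∀ k, inner ℂ (b k) e = star (b k o) := by
    intro k; simp [e, EuclideanSpace.inner_single_right]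
  have hsum : ∑ k, ‖inner ℂ (b k) e‖ ^ 2 = 1 := by
    rw [b.sum_sq_norm_inner_right]; simp [e]
  let U : (ℝ → ℂ) →ₗ[ℂ] (ι → ℂ) :=
    { toFun := fun h n => ∑ k, (h (lam k) * inner ℂ (b k) e) * b k n
      map_add' := by
        intro h g; ext n; simp [add_mul, Finset.sum_add_distrib]
      map_smul' := by
        intro c h; ext n; simp [Finset.mul_sum, mul_assoc] }
  have hU : ∀ h n, U h n = ∑ k, (h (lam k) * inner ℂ (b k) e) * b k n := fun _ _ => rfl
  have hUv : ∀ h, WithLp.toLp 2 (U h) = b.repr.symm (WithLp.toLp 2 fun k => h (lam k) * inner ℂ (b k) e) := by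
    intro h
    rw [← OrthonormalBasis.sum_repr_symm]
    ext n
    simp [hU]
  let ν : Measure ℝ := ∑ k, ENNReal.ofReal (‖inner ℂ (b k) e‖ ^ 2) • Measure.dirac (lam k)
  have hint : ∀ {E : Type} [NormedAddCommGroup E] [NormedSpace ℝ E] (h : ℝ → E), Integrable h ν := by
    intro E _ _ h
    refine integrable_finsetSum_measure.2 fun k _ => ?_
    refine Integrable.smul_measure ?_ (by simp)
    exact integrable_dirac (by simp)
  have hνint : ∀ {E : Type} [NormedAddCommGroup E] [NormedSpace ℝ E] [CompleteSpace E] (h : ℝ → E),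
      ∫ x, h x ∂ν = ∑ k, ‖inner ℂ (b k) e‖ ^ 2 • h (lam k) := by
    intro E _ _ _ h
    rw [integral_finsetSum_measure]
    · refine Finset.sum_congr rfl fun k _ => ?_
      rw [integral_smul_measure, integral_dirac, ENNReal.toReal_ofReal (by positivity)]
    · exact fun k hk => integrable_finsetSum_measure.1 (hint h) k hk
  refine ⟨ν, U, ⟨?_⟩, ?_, ?_, ?_, ?_, fun h => hint h⟩
  · simp only [ν, Measure.coe_finsetSum, Finset.sum_apply, Measure.smul_apply, measure_univ,
      smul_eq_mul, mul_one]
    rw [← ENNReal.ofReal_sum_of_nonneg (fun _ _ => by positivity), hsum]; simp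
  · have : WithLp.toLp 2 (U 1) = e := by
      rw [hUv, LinearIsometryEquiv.symm_apply_eq]
      ext k
      simp [OrthonormalBasis.repr_apply_apply]
    have h2 := congrArg WithLp.ofLp this
    simpa [e] using h2
  · intro h
    have : U h = ∑ k, (h (lam k) * inner ℂ (b k) e) • (b k).ofLp := by
      ext n; simp [hU]
    rw [this, Matrix.mulVec_sum]
    ext n
    simp only [Matrix.mulVec_smul, hb, hA.mulVec_eigenvectorBasis, Finset.sum_apply, hU]
    refine Finset.sum_congr rfl fun k _ => ?_
    simp [hlam]; ring
  · intro h
    have := EuclideanSpace.norm_sq_eq (WithLp.toLp 2 (U h))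
    rw [hUv, LinearIsometryEquiv.norm_map, EuclideanSpace.norm_sq_eq, ← hUv] at this
    simp only at this
    rw [← this, hνint]
    refine Finset.sum_congr rfl fun k _ => ?_
    rw [norm_mul, mul_pow, smul_eq_mul, mul_comm]
  · intro h
    rw [hνint, hU]
    refine Finset.sum_congr rfl fun k _ => ?_
    rw [hbo, norm_star, ← Complex.normSq_eq_norm_sq, Complex.real_smul, Complex.normSq_eq_conj_mul_self]
    simp only [RCLike.star_def]; ring

/-- The matrix entries of the operator. -/
def entry {d : Domain} (V : d.sites → ℝ) (n m : d.sites) : ℂ :=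
  (if (m : ℤ) = n + 1 then 1 else 0) + (if (m : ℤ) = n - 1 then 1 else 0) +
    (if (m : ℤ) = n then (V n : ℂ) else 0)

theorem entry_star {d : Domain} (V : d.sites → ℝ) (n m : d.sites) :
    star (entry V n m) = entry V m n := by
  unfold entry
  by_cases h : (m : ℤ) = n
  · have : m = n := Subtype.ext h
    subst this
    simp
  · have h1 : ((n : ℤ) = m + 1) ↔ ((m : ℤ) = n - 1) := by omega
    have h2 : ((n : ℤ) = m - 1) ↔ ((m : ℤ) = n + 1) := by omega
    have h3 : ¬ ((n : ℤ) = m) := by omega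
    simp only [h, h1, h2, h3, if_false, add_zero, RCLike.star_def, map_add]
    split_ifs <;> simp

theorem entry_eq_zero {d : Domain} (V : d.sites → ℝ) {n m : d.sites}
    (h : 1 < |(n : ℤ) - m|) : entry V n m = 0 := by
  unfold entry
  rw [lt_abs] at h
  have h1 : ¬ ((m : ℤ) = n + 1) := by omega
  have h2 : ¬ ((m : ℤ) = n - 1) := by omega
  have h3 : ¬ ((m : ℤ) = n) := by omega
  simp [h1, h2, h3]

theorem sum_zeroExt {d : Domain} (F : Finset d.sites) (f : d.sites → ℂ) (k : ℤ)
    (hk : ∀ h : k ∈ d.sites, (⟨k, h⟩ : d.sites) ∈ F) :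
    ∑ m ∈ F, (if (m : ℤ) = k then (1 : ℂ) else 0) * f m = zeroExt f k := by
  by_cases h : k ∈ d.sites
  · rw [Finset.sum_eq_single_of_mem ⟨k, h⟩ (hk h)]
    · simp [zeroExt, h]
    · intro b _ hb
      rw [if_neg, zero_mul]
      exact fun h' => hb (Subtype.ext h')
  · rw [zeroExt_of_notMem f h]
    refine Finset.sum_eq_zero fun m _ => ?_
    rw [if_neg, zero_mul]
    rintro rfl
    exact h m.2

theorem sum_entry {d : Domain} (V : d.sites → ℝ) (F : Finset d.sites) (f : d.sites → ℂ)
    (n : d.sites) (hF : ∀ m : d.sites, |(n : ℤ) - m| ≤ 1 → m ∈ F) :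
    ∑ m ∈ F, entry V n m * f m = expr V f n := by
  have h1 := sum_zeroExt F f (n + 1) (fun h => hF _ (by simp))
  have h2 := sum_zeroExt F f (n - 1) (fun h => hF _ (by simp))
  have h3 := sum_zeroExt F f n (fun h => hF _ (by simp))
  rw [zeroExt_coe] at h3
  rw [expr, ← h1, ← h2, ← h3, Finset.mul_sum, ← Finset.sum_add_distrib, ← Finset.sum_add_distrib]
  refine Finset.sum_congr rfl fun m _ => ?_
  unfold entry
  split_ifs <;> ring

theorem near_finite {d : Domain} (n : d.sites) (r : ℤ) :
    {m : d.sites | |(n : ℤ) - m| ≤ r}.Finite := by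
  refine Set.Finite.of_finite_image (f := ((↑) : d.sites → ℤ)) ?_ Subtype.val_injective.injOn
  refine (Set.finite_Icc ((n : ℤ) - r) (n + r)).subset ?_
  rintro _ ⟨m, hm, rfl⟩
  have := abs_le.1 (show |(n : ℤ) - m| ≤ r from hm)
  constructor <;> omega

theorem sum_le_sum_of_support {ι : Type*} (f : ι → ℝ) (hf : ∀ i, 0 ≤ f i) (s t : Finset ι)
    (h : ∀ i, f i ≠ 0 → i ∈ t) : ∑ i ∈ s, f i ≤ ∑ i ∈ t, f i := by
  classical
  rw [← Finset.sum_filter_ne_zero s]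
  refine Finset.sum_le_sum_of_subset_of_nonneg ?_ fun i _ _ => hf i
  intro i hi
  exact h i (Finset.mem_filter.1 hi).2

/-- The fourth moments of the spectral measures of the finite sections are bounded. -/
theorem section_bound {d : Domain} (V : d.sites → ℝ) (o : d.sites) :
    ∃ K : ℝ, 0 ≤ K ∧ ∀ F : Finset d.sites,
      ∑ n ∈ F, ‖∑ m ∈ F, entry V n m * entry V m o‖ ^ 2 ≤ K := by
  let G : Finset d.sites := (near_finite o 2).toFinset
  have hG : ∀ m, m ∈ G ↔ |(o : ℤ) - m| ≤ 2 := by simp [G]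
  refine ⟨∑ n ∈ G, (∑ m ∈ G, ‖entry V n m * entry V m o‖) ^ 2, by positivity, fun F => ?_⟩
  have hz : ∀ n m : d.sites, entry V n m * entry V m o ≠ 0 → m ∈ G ∧ n ∈ G := by
    intro n m h
    have h1 : |(n : ℤ) - m| ≤ 1 := not_lt.1 fun h' => h (by rw [entry_eq_zero V h', zero_mul])
    have h2 : |(m : ℤ) - o| ≤ 1 := not_lt.1 fun h' => h (by rw [entry_eq_zero V h', mul_zero])
    rw [hG, hG]
    rw [abs_le] at *
    rw [abs_le]
    omega
  calc ∑ n ∈ F, ‖∑ m ∈ F, entry V n m * entry V m o‖ ^ 2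
      ≤ ∑ n ∈ F, (∑ m ∈ G, ‖entry V n m * entry V m o‖) ^ 2 := by
        gcongr with n _
        refine (norm_sum_le _ _).trans ?_
        refine sum_le_sum_of_support _ (fun _ => norm_nonneg _) _ _ fun m hm => ?_
        exact (hz n m (norm_ne_zero_iff.1 hm)).1
    _ ≤ _ := by
        refine sum_le_sum_of_support _ (fun _ => by positivity) _ _ fun n hn => ?_
        obtain ⟨m, _, hm⟩ := Finset.exists_ne_zero_of_sum_ne_zero (pow_ne_zero_iff two_ne_zero |>.1 hn)
        exact (hz n m (norm_ne_zero_iff.1 hm)).2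

/-- Spectral resolution of a finite section, extended by zero: `W h = h(H_F) δ_o`. -/
theorem section_spectral {d : Domain} (V : d.sites → ℝ) (o : d.sites) (F : Finset d.sites)
    (ho : o ∈ F) :
    ∃ (ν : ProbabilityMeasure ℝ) (W : (ℝ → ℂ) →ₗ[ℂ] (d.sites → ℂ)),
      W 1 = Pi.single o 1 ∧
      (∀ h (n : d.sites), (∀ m : d.sites, |(n : ℤ) - m| ≤ 1 → m ∈ F) →
        expr V (W h) n = W (fun x => (x : ℂ) * h x) n) ∧
      (∀ h (s : Finset d.sites), ∑ n ∈ s, ‖W h n‖ ^ 2 ≤ ∫ x, ‖h x‖ ^ 2 ∂(ν : Measure ℝ)) ∧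
      (∀ h, W h o = ∫ x, h x ∂(ν : Measure ℝ)) ∧
      (∀ h : ℝ → ℝ, Integrable h (ν : Measure ℝ)) ∧
      ∫ x, x ^ 4 ∂(ν : Measure ℝ) =
        ∑ n ∈ F, ‖∑ m ∈ F, entry V n m * entry V m o‖ ^ 2 := by
  classical
  let A : Matrix F F ℂ := Matrix.of fun n m => entry V n m
  have hA : A.IsHermitian := by
    ext n m
    exact entry_star V m n
  obtain ⟨ν, U, hν, h1, h2, h3, h4, h5⟩ := finite_spectral A hA ⟨o, ho⟩
  let W : (ℝ → ℂ) →ₗ[ℂ] (d.sites → ℂ) :=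
    { toFun := fun h n => if hn : n ∈ F then U h ⟨n, hn⟩ else 0
      map_add' := by intro h g; ext n; by_cases hn : n ∈ F <;> simp [hn]
      map_smul' := by intro c h; ext n; by_cases hn : n ∈ F <;> simp [hn] }
  have hW : ∀ h n, W h n = if hn : n ∈ F then U h ⟨n, hn⟩ else 0 := fun _ _ => rfl
  have hWF : ∀ h (n : F), W h n = U h n := by intro h n; simp [hW]
  refine ⟨⟨ν, hν⟩, W, ?_, ?_, ?_, ?_, h5, ?_⟩
  · ext n
    by_cases hn : n ∈ F
    · simp [hW, hn, h1, Pi.single_apply]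
    · have : n ≠ o := by rintro rfl; exact hn ho
      simp [hW, hn, this]
  · intro h n hn
    have hnF : n ∈ F := hn n (by simp)
    rw [← sum_entry V F _ n hn, hW, dif_pos hnF, ← h2, Matrix.mulVec, dotProduct,
      ← Finset.sum_coe_sort]
    refine Finset.sum_congr rfl fun m _ => ?_
    rw [hWF]; rfl
  · intro h s
    refine le_trans ?_ (h3 h).le
    have e : ∑ n, ‖U h n‖ ^ 2 = ∑ n ∈ F, ‖W h n‖ ^ 2 := by
      rw [← Finset.sum_coe_sort F]
      exact Finset.sum_congr rfl fun n _ => by rw [hWF h n]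
    rw [e]
    refine sum_le_sum_of_support _ (fun _ => by positivity) _ _ fun n hn => ?_
    by_contra hnF
    exact hn (by simp [hW, hnF])
  · intro h
    rw [hW, dif_pos ho, h4]; rfl
  · have e : U (fun x : ℝ => (x : ℂ) * ((x : ℂ) * 1)) = A.mulVec (A.mulVec (Pi.single ⟨o, ho⟩ 1)) := by
      rw [← h1, h2, h2]; rfl
    have e3 : A.mulVec (Pi.single ⟨o, ho⟩ 1) = fun m : F => entry V m o := by
      ext m
      rw [Matrix.mulVec_single_one]; rfl
    have h6 := h3 (fun x : ℝ => (x : ℂ) * ((x : ℂ) * 1))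
    rw [e] at h6
    have e2 : ∀ x : ℝ, ‖(x : ℂ) * ((x : ℂ) * 1)‖ ^ 2 = x ^ 4 := by
      intro x
      rw [norm_mul, norm_mul, norm_one, Complex.norm_real, Real.norm_eq_abs]
      rw [show (|x| * (|x| * 1)) ^ 2 = (|x| ^ 2) ^ 2 by ring, sq_abs]; ring
    simp_rw [e2] at h6
    change ∫ x, x ^ 4 ∂ν = _
    rw [← h6, ← Finset.sum_coe_sort F]
    refine Finset.sum_congr rfl fun n _ => ?_
    rw [← Finset.sum_coe_sort F, e3]
    rfl

/-- Spectral resolution of the operator at `δ_o`, as a limit of finite sections: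
`R h = h(H) δ_o` for functions of at most quadratic growth, with the spectral measure `μ`. -/
theorem exists_resolution {d : Domain} (V : d.sites → ℝ) (o : d.sites) :
    ∃ (μ : ProbabilityMeasure ℝ) (R : (ℝ → ℂ) → d.ell2) (K : ℝ), 0 ≤ K ∧
      R 1 = lp.single 2 o 1 ∧
      (∀ (h k : ℝ → ℂ) (a b : ℂ) (c c' : ℝ), (∀ x, ‖h x‖ ≤ c * (1 + x ^ 2)) →
        (∀ x, ‖k x‖ ≤ c' * (1 + x ^ 2)) → R (a • h + b • k) = a • R h + b • R k) ∧
      (∀ (h : ℝ → ℂ) (c c' : ℝ), (∀ x, ‖h x‖ ≤ c * (1 + x ^ 2)) →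
        (∀ x : ℝ, ‖(x : ℂ) * h x‖ ≤ c' * (1 + x ^ 2)) →
          expr V (R h) = R (fun x => (x : ℂ) * h x)) ∧
      (∀ (h : ℝ → ℂ) (c : ℝ), (∀ x, ‖h x‖ ≤ c * (1 + x ^ 2)) → ‖R h‖ ≤ c * K) ∧
      (∀ (h : ℝ → ℂ) (c : ℝ), (∀ x, ‖h x‖ ≤ c) → Continuous h →
        R h o = ∫ x, h x ∂(μ : Measure ℝ)) := by
  obtain ⟨K, hK, hKF⟩ := section_bound V o
  have hex := fun (F : Finset d.sites) (ho : o ∈ F) => section_spectral V o F ho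
  have hex' : ∀ F : Finset d.sites, ∃ (ν : ProbabilityMeasure ℝ)
      (W : (ℝ → ℂ) →ₗ[ℂ] (d.sites → ℂ)), o ∈ F →
      W 1 = Pi.single o 1 ∧
      (∀ h (n : d.sites), (∀ m : d.sites, |(n : ℤ) - m| ≤ 1 → m ∈ F) →
        expr V (W h) n = W (fun x => (x : ℂ) * h x) n) ∧
      (∀ h (s : Finset d.sites), ∑ n ∈ s, ‖W h n‖ ^ 2 ≤ ∫ x, ‖h x‖ ^ 2 ∂(ν : Measure ℝ)) ∧
      (∀ h, W h o = ∫ x, h x ∂(ν : Measure ℝ)) ∧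
      (∀ h : ℝ → ℝ, Integrable h (ν : Measure ℝ)) ∧
      ∫ x, x ^ 4 ∂(ν : Measure ℝ) ≤ K := by
    intro F
    by_cases ho : o ∈ F
    · obtain ⟨ν, W, h1, h2, h3, h4, h5, h6⟩ := hex F ho
      exact ⟨ν, W, fun _ => ⟨h1, h2, h3, h4, h5, h6.trans_le (hKF F)⟩⟩
    · exact ⟨⟨Measure.dirac 0, inferInstance⟩, 0, fun h => absurd h ho⟩
  choose ν W hp using hex'
  let U : Ultrafilter (Finset d.sites) := Ultrafilter.of atTop
  have hU : (U : Filter (Finset d.sites)) ≤ atTop := Ultrafilter.of_le _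
  have hUo : ∀ᶠ F in (U : Filter (Finset d.sites)), o ∈ F :=
    hU ((eventually_ge_atTop ({o} : Finset d.sites)).mono fun F hF => by simpa using hF)
  -- uniform bounds
  have hbd : ∀ (h : ℝ → ℂ) (c : ℝ), (∀ x, ‖h x‖ ≤ c * (1 + x ^ 2)) →
      ∀ F, o ∈ F → ∀ s : Finset d.sites, ∑ n ∈ s, ‖W F h n‖ ^ 2 ≤ c ^ 2 * (2 + 2 * K) := by
    intro h c hc F ho s
    obtain ⟨-, -, h3, -, h5, h6⟩ := hp F ho
    calc ∑ n ∈ s, ‖W F h n‖ ^ 2 ≤ ∫ x, ‖h x‖ ^ 2 ∂(ν F : Measure ℝ) := h3 h s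
      _ ≤ ∫ x, c ^ 2 * (2 + 2 * x ^ 4) ∂(ν F : Measure ℝ) := by
        refine integral_mono (h5 _) (h5 _) fun x => ?_
        calc ‖h x‖ ^ 2 ≤ (c * (1 + x ^ 2)) ^ 2 := by gcongr; exact hc x
          _ = c ^ 2 * (1 + x ^ 2) ^ 2 := by ring
          _ ≤ c ^ 2 * (2 + 2 * x ^ 4) := by
            gcongr; nlinarith [sq_nonneg (1 - x ^ 2)]
      _ = c ^ 2 * (2 + 2 * ∫ x, x ^ 4 ∂(ν F : Measure ℝ)) := by
        rw [integral_const_mul, integral_add (h5 _) (h5 _), integral_const_mul]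
        simp
      _ ≤ _ := by gcongr
  have hlim : ∀ (h : ℝ → ℂ) (c : ℝ), (∀ x, ‖h x‖ ≤ c * (1 + x ^ 2)) → ∀ n,
      ∃ a, Tendsto (fun F => W F h n) U (𝓝 a) := by
    intro h c hc n
    have hB : ∀ᶠ F in (U : Filter (Finset d.sites)),
        W F h n ∈ Metric.closedBall (0 : ℂ) (√(c ^ 2 * (2 + 2 * K))) := by
      filter_upwards [hUo] with F ho
      rw [mem_closedBall_zero_iff]
      refine Real.le_sqrt_of_sq_le ?_
      simpa using hbd h c hc F ho {n}
    obtain ⟨a, -, ha⟩ := (isCompact_closedBall (0 : ℂ) _).ultrafilter_le_nhds'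
      (U.map fun F => W F h n) hB
    exact ⟨a, ha⟩
  let f : (ℝ → ℂ) → d.sites → ℂ := fun h n => limUnder (U : Filter _) fun F => W F h n
  have hf : ∀ (h : ℝ → ℂ) (c : ℝ), (∀ x, ‖h x‖ ≤ c * (1 + x ^ 2)) → ∀ n,
      Tendsto (fun F => W F h n) U (𝓝 (f h n)) := fun h c hc n =>
    tendsto_nhds_limUnder (hlim h c hc n)
  have hsum : ∀ (h : ℝ → ℂ) (c : ℝ), (∀ x, ‖h x‖ ≤ c * (1 + x ^ 2)) →
      ∀ s : Finset d.sites, ∑ n ∈ s, ‖f h n‖ ^ 2 ≤ c ^ 2 * (2 + 2 * K) := by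
    intro h c hc s
    refine le_of_tendsto (tendsto_finsetSum s fun n _ => ((hf h c hc n).norm.pow 2)) ?_
    filter_upwards [hUo] with F ho using hbd h c hc F ho s
  have hmem : ∀ (h : ℝ → ℂ) (c : ℝ), (∀ x, ‖h x‖ ≤ c * (1 + x ^ 2)) → Memℓp (f h) 2 :=
    fun h c hc => memℓp_gen' (C := c ^ 2 * (2 + 2 * K)) fun s => by simpa using hsum h c hc s
  classical
  let R : (ℝ → ℂ) → d.ell2 := fun h => if hm : Memℓp (f h) 2 then ⟨f h, hm⟩ else 0
  have hR : ∀ (h : ℝ → ℂ) (c : ℝ), (∀ x, ‖h x‖ ≤ c * (1 + x ^ 2)) → ∀ n, R h n = f h n := by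
    intro h c hc n
    simp only [R, dif_pos (hmem h c hc)]
  -- the weak limit of the measures
  have htight : ∀ F, o ∈ F → ∀ n : ℕ, ν F (Metric.closedBall (0 : ℝ) n)ᶜ ≤
      Real.toNNReal ((K + 1) / (n + 1)) := by
    intro F ho n
    obtain ⟨-, -, -, -, h5, h6⟩ := hp F ho
    rw [← ENNReal.coe_le_coe, ProbabilityMeasure.ennreal_coeFn_eq_coeFn_toMeasure,
      ← ENNReal.ofReal, ENNReal.le_ofReal_iff_toReal_le (measure_ne_top _ _) (by positivity)]
    change (ν F : Measure ℝ).real _ ≤ _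
    have hm := mul_meas_ge_le_integral_of_nonneg (μ := (ν F : Measure ℝ))
      (f := fun x : ℝ => x ^ 4 + 1)
      (ae_of_all _ fun x => by positivity) (h5 _) (n + 1 : ℝ)
    rw [integral_add (h5 _) (h5 _)] at hm
    rw [le_div_iff₀ (by positivity), mul_comm]
    have hsub : (Metric.closedBall (0 : ℝ) n)ᶜ ⊆ {x : ℝ | (n + 1 : ℝ) ≤ x ^ 4 + 1} := by
      intro x hx
      simp only [Set.mem_compl_iff, mem_closedBall_zero_iff, not_le, Real.norm_eq_abs] at hx
      have hx4 : x ^ 4 = |x| ^ 4 := (Even.pow_abs (by decide) x).symm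
      simp only [Set.mem_ofPred_eq, hx4, add_le_add_iff_right]
      rcases Nat.eq_zero_or_pos n with rfl | hn
      · simp
      · have : (1 : ℝ) ≤ n := by exact_mod_cast hn
        have h1 : (1 : ℝ) ≤ |x| := this.trans hx.le
        calc (n : ℝ) ≤ |x| := hx.le
          _ ≤ |x| ^ 4 := le_self_pow₀ h1 (by norm_num)
    calc (n + 1 : ℝ) * (ν F : Measure ℝ).real (Metric.closedBall (0 : ℝ) n)ᶜ
        ≤ (n + 1 : ℝ) * (ν F : Measure ℝ).real {x : ℝ | (n + 1 : ℝ) ≤ x ^ 4 + 1} :=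
          mul_le_mul_of_nonneg_left (measureReal_mono hsub (measure_ne_top _ _)) (by positivity)
      _ ≤ _ := hm
      _ ≤ _ := by simpa using h6
  obtain ⟨μ, -, hμ⟩ := (isCompact_setOfPred_probabilityMeasure_mass_eq_compl_isCompact_le
    (E := ℝ) (u := fun n : ℕ => Real.toNNReal ((K + 1) / (n + 1)))
    (K := fun n : ℕ => Metric.closedBall (0 : ℝ) n) (by
      rw [← Real.toNNReal_zero]
      exact (continuous_real_toNNReal.tendsto 0).comp
        (tendsto_const_nhds.div_atTop (tendsto_natCast_atTop_atTop.atTop_add tendsto_const_nhds)))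
    (fun n => isCompact_closedBall _ _) (Or.inl inferInstance)).ultrafilter_le_nhds'
    (U.map ν) (by
      change ∀ᶠ F in (U : Filter (Finset d.sites)), _
      filter_upwards [hUo] with F ho using htight F ho)
  have hμ' : Tendsto ν U (𝓝 μ) := hμ
  refine ⟨μ, R, √(2 + 2 * K), Real.sqrt_nonneg _, ?_, ?_, ?_, ?_, ?_⟩
  · ext n
    have hb : ∀ x : ℝ, ‖(1 : ℝ → ℂ) x‖ ≤ 1 * (1 + x ^ 2) := by
      intro x; simp; positivity
    rw [hR 1 1 hb]
    refine tendsto_nhds_unique (hf 1 1 hb n) ?_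
    refine tendsto_const_nhds.congr' ?_
    filter_upwards [hUo] with F ho
    rw [(hp F ho).1, lp.coeFn_single]
  · intro h k a b c c' hc hc'
    have hb : ∀ x : ℝ, ‖(a • h + b • k) x‖ ≤ (‖a‖ * c + ‖b‖ * c') * (1 + x ^ 2) := by
      intro x
      calc ‖(a • h + b • k) x‖ ≤ ‖a‖ * ‖h x‖ + ‖b‖ * ‖k x‖ := by
            simpa using norm_add_le (a * h x) (b * k x)
        _ ≤ ‖a‖ * (c * (1 + x ^ 2)) + ‖b‖ * (c' * (1 + x ^ 2)) := by
            gcongr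
            · exact hc x
            · exact hc' x
        _ = _ := by ring
    ext n
    simp only [lp.coeFn_add, lp.coeFn_smul, Pi.add_apply, Pi.smul_apply]
    rw [hR _ _ hb, hR _ _ hc, hR _ _ hc']
    refine tendsto_nhds_unique (hf _ _ hb n) ?_
    simpa using ((hf h c hc n).const_mul a).add ((hf k c' hc' n).const_mul b)
  · intro h c c' hc hc'
    have e : ((R h : d.ell2) : d.sites → ℂ) = f h := funext (hR h c hc)
    ext n
    rw [e, hR _ _ hc']
    refine tendsto_nhds_unique ?_ (hf _ _ hc' n)
    have hz : ∀ k : ℤ, Tendsto (fun F => zeroExt (W F h) k) U (𝓝 (zeroExt (f h) k)) := by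
      intro k
      by_cases hk : k ∈ d.sites
      · simpa [zeroExt, hk] using hf h c hc ⟨k, hk⟩
      · simp [zeroExt, hk]
    have ht : Tendsto (fun F => expr V (W F h) n) U (𝓝 (expr V (f h) n)) :=
      ((hz _).add (hz _)).add ((hf h c hc n).const_mul _)
    refine ht.congr' ?_
    have hn : ∀ᶠ F in (U : Filter (Finset d.sites)),
        ∀ m : d.sites, |(n : ℤ) - m| ≤ 1 → m ∈ F :=
      hU ((eventually_ge_atTop (near_finite n 1).toFinset).mono fun F hF m hm =>
        hF (by simpa using hm))
    filter_upwards [hUo, hn] with F ho hn using (hp F ho).2.1 h n hn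
  · intro h c hc
    have hc0 : 0 ≤ c := by simpa using (norm_nonneg _).trans (hc 0)
    refine lp.norm_le_of_forall_sum_le (by simp) (by positivity) fun s => ?_
    have e : (c * √(2 + 2 * K)) ^ 2 = c ^ 2 * (2 + 2 * K) := by
      rw [mul_pow, Real.sq_sqrt (by positivity)]
    simpa [e, hR h c hc] using hsum h c hc s
  · intro h c hc hcont
    have hc0 : 0 ≤ c := (norm_nonneg _).trans (hc 0)
    have hb : ∀ x : ℝ, ‖h x‖ ≤ c * (1 + x ^ 2) := fun x =>
      (hc x).trans (le_mul_of_one_le_right hc0 (by nlinarith [sq_nonneg x]))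
    rw [hR h c hb]
    refine tendsto_nhds_unique (hf h c hb o) ?_
    have ht := (ProbabilityMeasure.tendsto_iff_forall_integral_rclike_tendsto ℂ).1 hμ'
      (BoundedContinuousFunction.ofNormedAddCommGroup h hcont c hc)
    refine Tendsto.congr' ?_ ht
    filter_upwards [hUo] with F ho
    exact ((hp F ho).2.2.2.1 h).symm

theorem norm_exp_sub_le (y : ℝ) :
    ‖Complex.exp (Complex.I * y) - 1 - Complex.I * y‖ ≤ 2 * y ^ 2 := by
  rcases le_or_gt |y| 1 with h | h
  · have h1 : ‖Complex.I * (y : ℂ)‖ = |y| := by simp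
    have := Complex.norm_exp_sub_one_sub_id_le (x := Complex.I * y) (by rw [h1]; exact h)
    rw [h1, sq_abs] at this
    nlinarith [sq_nonneg y]
  · have h1 : ‖Complex.I * (y : ℂ)‖ = |y| := by simp
    have h2 := Real.norm_exp_I_mul_ofReal_sub_one_le (x := y)
    have h3 := norm_sub_le (Complex.exp (Complex.I * y) - 1) (Complex.I * y)
    rw [h1] at h3
    rw [Real.norm_eq_abs] at h2
    nlinarith [sq_abs y, abs_nonneg y]

/-- Existence of the evolution `e^{-itH} δ₁`, of the resolvent `(H - z)⁻¹ δ₁`, and of a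
probability measure that represents both. -/
theorem exists_evolution_measure {d : Domain} (V : d.sites → ℝ) :
    ∃ (ψ : ℝ → d.ell2) (μ : ProbabilityMeasure ℝ), IsEvolution V ψ ∧
      (∀ t : ℝ, ψ t d.one = ∫ x : ℝ, Complex.exp (-Complex.I * t * x) ∂(μ : Measure ℝ)) ∧
      ∀ z : ℂ, z.im ≠ 0 → ∃ φ : (hamiltonian V).domain,
        hamiltonian V φ - z • (φ : d.ell2) = delta d ∧
        (φ : d.ell2) d.one = ∫ x : ℝ, 1 / ((x : ℂ) - z) ∂(μ : Measure ℝ) := by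
  obtain ⟨μ, R, K, hK, h1, hlin, hmul, hnorm, hint⟩ := exists_resolution V d.one
  let e : ℝ → ℝ → ℂ := fun t x => Complex.exp (-Complex.I * t * x)
  have he : ∀ t x, ‖e t x‖ = 1 := by
    intro t x
    have : -Complex.I * t * x = ((-(t * x) : ℝ) : ℂ) * Complex.I := by push_cast; ring
    simp only [e, this, Complex.norm_exp_ofReal_mul_I]
  have hb0 : ∀ t x, ‖e t x‖ ≤ 1 * (1 + x ^ 2) := by
    intro t x; rw [he]; nlinarith [sq_nonneg x]
  have hb1 : ∀ t (x : ℝ), ‖(x : ℂ) * e t x‖ ≤ 1 * (1 + x ^ 2) := by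
    intro t x
    rw [norm_mul, he, Complex.norm_real, Real.norm_eq_abs]
    nlinarith [sq_abs x, sq_nonneg (|x| - 1)]
  have hdom : ∀ t, R (e t) ∈ (hamiltonian V).domain := by
    intro t
    rw [mem_domain_iff, hmul (e t) 1 1 (hb0 t) (hb1 t)]
    exact lp.memℓp _
  have happ : ∀ t, hamiltonian V ⟨R (e t), hdom t⟩ = R (fun x => (x : ℂ) * e t x) := by
    intro t
    ext n
    rw [hamiltonian_apply, hmul (e t) 1 1 (hb0 t) (hb1 t)]
  refine ⟨fun t => R (e t), μ, ⟨?_, fun t => ⟨hdom t, ?_⟩⟩, ?_, ?_⟩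
  · have : e 0 = 1 := by ext x; simp [e]
    simp only [this, h1, delta]
  · rw [happ, hasDerivAt_iff_isLittleO_nhds_zero]
    have hO : (fun s : ℝ => R (e (t + s)) - R (e t) -
        s • -Complex.I • R (fun x => (x : ℂ) * e t x)) =O[𝓝 0] fun s : ℝ => s ^ 2 := by
      refine Asymptotics.IsBigO.of_bound (2 * K) (Eventually.of_forall fun s => ?_)
      let k : ℝ → ℂ := (1 : ℂ) • e (t + s) + (-1 : ℂ) • e t
      have hk : R k = (1 : ℂ) • R (e (t + s)) + (-1 : ℂ) • R (e t) :=
        hlin _ _ _ _ _ _ (hb0 _) (hb0 _)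
      have hkb : ∀ x, ‖k x‖ ≤ 2 * (1 + x ^ 2) := by
        intro x
        have : ‖k x‖ ≤ ‖e (t + s) x‖ + ‖e t x‖ := by
          simpa [k, ← sub_eq_add_neg] using norm_sub_le (e (t + s) x) (e t x)
        rw [he, he] at this
        nlinarith [sq_nonneg x]
      have hl := hlin k (fun x => (x : ℂ) * e t x) 1 (s * Complex.I) _ _ hkb (hb1 t)
      have heq : R (e (t + s)) - R (e t) - s • -Complex.I • R (fun x => (x : ℂ) * e t x) =
          R ((1 : ℂ) • k + (s * Complex.I : ℂ) • fun x : ℝ => (x : ℂ) * e t x) := by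
        have hs : (s • -Complex.I • R (fun x => (x : ℂ) * e t x) : d.ell2) =
            -((s * Complex.I : ℂ) • R (fun x => (x : ℂ) * e t x)) := by
          ext n
          simp only [lp.coeFn_smul, lp.coeFn_neg, Pi.neg_apply, Pi.smul_apply, smul_eq_mul,
            Complex.real_smul]
          ring
        rw [hl, hk, hs]
        simp only [one_smul, neg_smul]
        abel
      rw [heq]
      refine (hnorm _ (2 * s ^ 2) fun x => ?_).trans (by simp; linarith)
      have hx : ((1 : ℂ) • k + (s * Complex.I : ℂ) • fun x : ℝ => (x : ℂ) * e t x) x =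
          e t x * (Complex.exp (Complex.I * ((-(s * x) : ℝ) : ℂ)) - 1 -
            Complex.I * ((-(s * x) : ℝ) : ℂ)) := by
        have hadd : e (t + s) x = e t x * Complex.exp (Complex.I * ((-(s * x) : ℝ) : ℂ)) := by
          simp only [e, ← Complex.exp_add]
          congr 1; push_cast; ring
        simp only [k, Pi.add_apply, Pi.smul_apply, smul_eq_mul, hadd]
        push_cast; ring
      rw [hx, norm_mul, he, one_mul]
      refine (norm_exp_sub_le _).trans ?_
      nlinarith [sq_nonneg s, sq_nonneg (s * x)]
    exact hO.trans_isLittleO (Asymptotics.isLittleO_pow_id (by norm_num))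
  · intro t
    exact hint (e t) 1 (fun x => (he t x).le) (by fun_prop)
  · intro z hz
    let g : ℝ → ℂ := fun x => 1 / ((x : ℂ) - z)
    have hne : ∀ x : ℝ, (x : ℂ) - z ≠ 0 := by
      intro x h0
      apply hz
      have := congrArg Complex.im h0
      simpa using this
    have hg : ∀ x, ‖g x‖ ≤ 1 / |z.im| := by
      intro x
      simp only [g, norm_div, norm_one]
      have h0 : 0 < |z.im| := abs_pos.2 hz
      refine one_div_le_one_div_of_le h0 ?_
      have := Complex.abs_im_le_norm ((x : ℂ) - z)
      simpa using this
    have hz0 : (0 : ℝ) ≤ 1 / |z.im| := by positivity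
    have hgb : ∀ x : ℝ, ‖g x‖ ≤ 1 / |z.im| * (1 + x ^ 2) := fun x =>
      (hg x).trans (le_mul_of_one_le_right hz0 (by nlinarith [sq_nonneg x]))
    have hone : ∀ x : ℝ, ‖(1 : ℝ → ℂ) x‖ ≤ 1 * (1 + x ^ 2) := by
      intro x; simp; positivity
    have hxg : (fun x : ℝ => (x : ℂ) * g x) = (1 : ℂ) • (1 : ℝ → ℂ) + z • g := by
      ext x
      simp only [g, Pi.add_apply, Pi.smul_apply, Pi.one_apply, smul_eq_mul]
      field_simp [hne x]
      ring
    have hxgb : ∀ x : ℝ, ‖(x : ℂ) * g x‖ ≤ (1 + ‖z‖ * (1 / |z.im|)) * (1 + x ^ 2) := by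
      intro x
      have h0 : (x : ℂ) * g x = 1 + z * g x := by simpa using congrFun hxg x
      rw [h0]
      calc ‖1 + z * g x‖ ≤ 1 + ‖z‖ * ‖g x‖ := by simpa using norm_add_le 1 (z * g x)
        _ ≤ 1 + ‖z‖ * (1 / |z.im|) := by gcongr; exact hg x
        _ ≤ _ := le_mul_of_one_le_right (by positivity) (by nlinarith [sq_nonneg x])
    have hexp := hmul g _ _ hgb hxgb
    have hm : R g ∈ (hamiltonian V).domain := by
      rw [mem_domain_iff, hexp]
      exact lp.memℓp _
    refine ⟨⟨R g, hm⟩, ?_, hint g _ hg ?_⟩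
    · have : hamiltonian V ⟨R g, hm⟩ = R (fun x : ℝ => (x : ℂ) * g x) := by
        ext n
        rw [hamiltonian_apply, hexp]
      rw [this, hxg, hlin _ _ _ _ _ _ hone hgb, h1, delta]
      simp
    · exact continuous_const.div (by fun_prop) hne

/-- The time evolution `t ↦ e^{-itH} δ₁`, the unique solution of the Schrödinger equation with
initial value `δ₁`. -/
def evolution {d : Domain} (V : d.sites → ℝ) : ℝ → d.ell2 :=
  Classical.choose (exists_evolution_measure V)

theorem evolution_spec {d : Domain} (V : d.sites → ℝ) : IsEvolution V (evolution V) := by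
  obtain ⟨μ, h, -⟩ := Classical.choose_spec (exists_evolution_measure V)
  exact h

/-- `μ` is the spectral measure of `H` and `δ₁`: `⟨f(H) δ₁, δ₁⟩ = ∫ f dμ` for the functions
`f(x) = e^{-itx}` and `f(x) = 1 / (x - z)`. (Either family alone determines `μ`. The vector `φ` is
`(H - z)⁻¹ δ₁`, and the coordinate at the site `1` is the inner product with `δ₁`.) -/
def IsSpectralMeasure {d : Domain} (V : d.sites → ℝ) (μ : Measure ℝ) : Prop :=
  IsProbabilityMeasure μ ∧
    (∀ t : ℝ, evolution V t d.one = ∫ x : ℝ, Complex.exp (-Complex.I * t * x) ∂μ) ∧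
    ∀ z : ℂ, z.im ≠ 0 → ∃ φ : (hamiltonian V).domain,
      hamiltonian V φ - z • (φ : d.ell2) = delta d ∧
      (φ : d.ell2) d.one = ∫ x : ℝ, 1 / ((x : ℂ) - z) ∂μ

theorem exists_spectralMeasure {d : Domain} (V : d.sites → ℝ) :
    ∃ μ : Measure ℝ, IsSpectralMeasure V μ := by
  obtain ⟨μ, -, h2, h3⟩ := Classical.choose_spec (exists_evolution_measure V)
  exact ⟨μ, inferInstance, h2, h3⟩

/-- The spectral measure of the operator `H` and the vector `δ₁`. -/
def spectralMeasure {d : Domain} (V : d.sites → ℝ) : Measure ℝ :=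
  Classical.choose (exists_spectralMeasure V)

theorem spectralMeasure_spec {d : Domain} (V : d.sites → ℝ) :
    IsSpectralMeasure V (spectralMeasure V) :=
  Classical.choose_spec (exists_spectralMeasure V)

/-- The Borel transform `F(z) = ∫ dμ(x) / (x - z) = ⟨(H - z)⁻¹ δ₁, δ₁⟩`. -/
def borelTransform {d : Domain} (V : d.sites → ℝ) (z : ℂ) : ℂ :=
  ∫ x : ℝ, 1 / ((x : ℂ) - z) ∂(spectralMeasure V)

/-- `I(Δ, ν) = ν ∫_Δ (Im F(E + iν))² dE`. -/
def energyIntegral {d : Domain} (V : d.sites → ℝ) (Δ : Set ℝ) (ν : ℝ) : ℝ :=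
  ν * ∫ E in Δ, (borelTransform V (E + Complex.I * ν)).im ^ 2

/-- The time-averaged probability `a(n, T) = (2/T) ∫_0^∞ e^{-2t/T} |⟨e^{-itH} δ₁, δ_n⟩|² dt`. -/
def avgProb {d : Domain} (V : d.sites → ℝ) (n : d.sites) (T : ℝ) : ℝ :=
  2 / T * ∫ t in Set.Ioi (0 : ℝ), Real.exp (-2 * t / T) * ‖evolution V t n‖ ^ 2

/-- The time-averaged moment `⟨|X|^p⟩(T) = ∑_n |n|^p a(n, T)`, a sum in `[0, ∞]`. -/
def moment {d : Domain} (V : d.sites → ℝ) (p T : ℝ) : ENNReal :=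
  ∑' n : d.sites, ENNReal.ofReal (|((n : ℤ) : ℝ)| ^ p * avgProb V n T)

end

end Schrodinger

namespace Schrodinger

/-! The mechanism is that a wave packet with spectral mass in `A` cannot stay on few sites unless
the energy integral over the neighbourhood of `A` is large. Write `m = μ(A)`, `ε = 1/T`, and let
`r(w)` be the average of `e^{-itw}` over exponentially distributed times of rate `2/T`.

The map `e^{-itx} ↦ ψ(t)` preserves inner products, so it extends to a contraction `W : L²(μ) → ℓ²`.
The vectors `u_n = W* δ_n` represent the evolution as `ψ(t)(n) = ∫ conj(u_n) e^{-itx} dμ`, and `W`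
applied to `1_A e^{-itx}` is the component `f(t)` of `ψ(t)` with energies in `A`
(`exists_eigenfunctions`). Averaging in time the overlap of `f(t)` and `ψ(t)` on a finite set `S`
gives the integral over `A × ℝ` of `∑_{n ∈ S} u_n(x) conj(u_n(y))` times `r(y - x)`. The first
factor has squared `L²` norm at most `|S|`, so the overlap is at most `m/2` once `|S| J ≤ m²/4`,
where `J` is the integral of `|r(y - x)|²` over `A × ℝ`. As the overlap over all sites is `m`,
average probability at least `m/4` then lies outside `S` (`sum_integral_norm_sq_le`).

For this law of times, `|r(w)|² = 4ε²/(4ε² + w²)`, which for `x ∈ A` and `w = y - x` is dominated by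
the integral over `A_{2ε}` of a product of two Poisson kernels. Hence `J ≤ 8 I(A_{2ε}, ε)`
(`integral_kernel_le`). Taking for `S` the sites closest to the origin, about `ν` of them, bounds
the moment below by `(ν/3)^p m/4` (`le_moment_of_kernel`).

The hypothesis bounds the energy integral by `X/g`, where `X` is the moment itself. The choice `ν =
m² g/(32 X)` is therefore admissible, and the resulting inequality for `X` solves to the claimed
power law. When this `ν` is below `1` there is no set to choose, and a bound independent of `T`, `V`
and `A` takes over (`moment_lower_bound_const`). -/

open scoped ComplexConjugate

/-! ### Partial isometries from equal Gram matrices. -/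

section PartialIsometry

variable {E F : Type*} [NormedAddCommGroup E] [InnerProductSpace ℂ E] [CompleteSpace E]
  [NormedAddCommGroup F] [InnerProductSpace ℂ F] [CompleteSpace F]

/-- Two families of vectors with the same Gram matrix are related by a partial isometry. -/
theorem exists_partialIsometry {ι : Type*} (e : ι → E) (f : ι → F)
    (h : ∀ i j, inner ℂ (f i) (f j) = inner ℂ (e i) (e j)) :
    ∃ W : E →L[ℂ] F, (∀ i, W (e i) = f i) ∧ (∀ x, ‖W x‖ ≤ ‖x‖) ∧
      ∀ i, ContinuousLinearMap.adjoint W (f i) = e i := by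
  let Φe := Finsupp.linearCombination ℂ e
  let Φf := Finsupp.linearCombination ℂ f
  have hinner : ∀ c, inner ℂ (Φf c) (Φf c) = inner ℂ (Φe c) (Φe c) := by
    intro c
    simp only [Φe, Φf, Finsupp.linearCombination_apply, Finsupp.sum, sum_inner, inner_sum,
      inner_smul_left, inner_smul_right, h]
  have hnorm : ∀ c, ‖Φf c‖ = ‖Φe c‖ := by
    intro c
    rw [@norm_eq_sqrt_re_inner ℂ, @norm_eq_sqrt_re_inner ℂ _ _ _ _ (Φe c), hinner]
  let K := (LinearMap.range Φe).topologicalClosure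
  have hmem : ∀ c, Φe c ∈ K := fun c => Submodule.le_topologicalClosure _ ⟨c, rfl⟩
  let g : (ι →₀ ℂ) →ₗ[ℂ] K := Φe.codRestrict K hmem
  have hg : ∀ c, (g c : E) = Φe c := fun _ => rfl
  have hdense : DenseRange g := by
    intro x
    rw [closure_subtype]
    have hx : (x : E) ∈ closure (LinearMap.range Φe : Set E) := x.2
    convert hx using 2
    ext y
    constructor
    · rintro ⟨_, ⟨c, rfl⟩, rfl⟩
      exact ⟨c, rfl⟩
    · rintro ⟨c, rfl⟩
      exact ⟨g c, ⟨c, rfl⟩, rfl⟩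
  have hb : ∀ c, ‖Φf c‖ ≤ 1 * ‖g c‖ := by
    intro c
    rw [one_mul, hnorm, ← hg]; rfl
  have : CompleteSpace K := (Submodule.isClosed_topologicalClosure _).completeSpace_coe
  -- Isometric on the closed span of the `e i`, zero on its orthogonal complement.
  let W : E →L[ℂ] F := (Φf.extendOfNorm g).comp K.orthogonalProjectionOnto
  have hW : ∀ i, W (e i) = f i := by
    intro i
    have h1 : Φe (Finsupp.single i 1) = e i := by simp [Φe]
    have h2 : K.orthogonalProjectionOnto (e i) = g (Finsupp.single i 1) := by
      have hm : e i ∈ K := h1 ▸ hmem _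
      rw [← h1]
      exact Submodule.orthogonalProjectionOnto_mem_subspace_eq_self (g (Finsupp.single i 1))
    change Φf.extendOfNorm g (K.orthogonalProjectionOnto (e i)) = f i
    rw [h2, LinearMap.extendOfNorm_eq hdense ⟨1, hb⟩]
    simp [Φf]
  have hW1 : ∀ x, ‖W x‖ ≤ ‖x‖ := by
    intro x
    have h1 := LinearMap.norm_extendOfNorm_apply_le hdense 1 hb (K.orthogonalProjectionOnto x)
    rw [one_mul] at h1
    exact h1.trans (K.norm_orthogonalProjectionOnto_apply_le x)
  refine ⟨W, hW, hW1, fun i => ?_⟩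
  have hfe : ‖f i‖ = ‖e i‖ := by
    rw [@norm_eq_sqrt_re_inner ℂ, @norm_eq_sqrt_re_inner ℂ _ _ _ _ (e i), h]
  have hadj : ‖ContinuousLinearMap.adjoint W (f i)‖ ≤ ‖f i‖ := by
    have hop : ‖ContinuousLinearMap.adjoint W‖ ≤ 1 := by
      rw [LinearIsometryEquiv.norm_map]
      exact W.opNorm_le_bound zero_le_one fun x => by simpa using hW1 x
    exact ((ContinuousLinearMap.adjoint W).le_of_opNorm_le hop _).trans (by simp)
  -- Equality case of Cauchy–Schwarz: the adjoint image of `f i` has norm at most `‖e i‖` and inner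
  -- product `‖e i‖ ^ 2` with `e i`, which forces it to be `e i`.
  have hcross : RCLike.re (inner ℂ (ContinuousLinearMap.adjoint W (f i)) (e i)) = ‖e i‖ ^ 2 := by
    rw [ContinuousLinearMap.adjoint_inner_left, hW, ← hfe, inner_self_eq_norm_sq]
  have hsq := @norm_sub_sq ℂ _ _ _ _ (ContinuousLinearMap.adjoint W (f i)) (e i)
  rw [hcross] at hsq
  have h0 : ‖ContinuousLinearMap.adjoint W (f i) - e i‖ ^ 2 ≤ 0 := by
    rw [hfe] at hadj
    nlinarith [norm_nonneg (ContinuousLinearMap.adjoint W (f i))]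
  exact sub_eq_zero.1 (norm_eq_zero.1 (pow_eq_zero_iff two_ne_zero |>.1
    (le_antisymm h0 (by positivity))))

end PartialIsometry

/-! ### Characters and the Gram matrix of the evolution. -/

/-- The character `x ↦ e^{-itx}`. -/
noncomputable def wave (t x : ℝ) : ℂ := Complex.exp (-Complex.I * t * x)

theorem norm_wave (t x : ℝ) : ‖wave t x‖ = 1 := by
  have : -Complex.I * t * x = ((-(t * x) : ℝ) : ℂ) * Complex.I := by push_cast; ring
  rw [wave, this, Complex.norm_exp_ofReal_mul_I]

theorem conj_wave (t x : ℝ) : conj (wave t x) = wave (-t) x := by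
  rw [wave, wave, ← Complex.exp_conj]
  simp

theorem conj_wave_mul_wave (s t x : ℝ) : conj (wave s x) * wave t x = wave (t - s) x := by
  rw [conj_wave, wave, wave, wave, ← Complex.exp_add]
  congr 1; push_cast; ring

theorem conj_wave_mul_wave' (t x y : ℝ) : conj (wave t x) * wave t y = wave t (y - x) := by
  rw [conj_wave, wave, wave, wave, ← Complex.exp_add]
  congr 1; push_cast; ring

theorem conj_wave_mul_self (t x : ℝ) : conj (wave t x) * wave t x = 1 := by
  rw [conj_wave_mul_wave, sub_self, wave]; simp

theorem continuous_wave (t : ℝ) : Continuous (wave t) := by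
  unfold wave; fun_prop

theorem continuous_wave_uncurry : Continuous fun q : ℝ × ℝ => wave q.1 q.2 := by
  unfold wave; fun_prop

/-- Symmetry of the operator makes the derivative in `s` vanish, so the inner product may be
evaluated at `s = 0`, where it is a coordinate at the site `1`. This replaces the unitary group law.
-/
theorem inner_evolution_add {d : Domain} {V : d.sites → ℝ} {ψ : ℝ → d.ell2}
    (hψ : IsEvolution V ψ) (r s : ℝ) : inner ℂ (ψ s) (ψ (s + r)) = ψ r d.one := by
  have hder : ∀ t, HasDerivAt (fun t => inner ℂ (ψ t) (ψ (t + r))) 0 t := by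
    intro t
    obtain ⟨h1, d1⟩ := hψ.2 t
    obtain ⟨h2, d2⟩ := hψ.2 (t + r)
    refine (d1.inner ℂ (d2.comp_add_const t r)).congr_deriv ?_
    have e := hamiltonian_symm V ⟨ψ t, h1⟩ ⟨ψ (t + r), h2⟩
    rw [inner_smul_left, inner_smul_right, e]
    simp
  have hc := is_const_of_deriv_eq_zero (fun t => (hder t).differentiableAt)
    (fun t => (hder t).deriv) s 0
  simp only [zero_add, hψ.1] at hc
  rw [hc, delta, lp.inner_single_left]
  simp

theorem inner_evolution {d : Domain} (V : d.sites → ℝ) (s t : ℝ) :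
    inner ℂ (evolution V s) (evolution V t) =
      ∫ x, conj (wave s x) * wave t x ∂(spectralMeasure V) := by
  have h := inner_evolution_add (evolution_spec V) (t - s) s
  rw [add_sub_cancel] at h
  rw [h, (spectralMeasure_spec V).2.1]
  simp only [conj_wave_mul_wave]
  rfl

/-! ### Generalized eigenfunctions. -/

theorem memLp_indicator_wave (μ : Measure ℝ) [IsProbabilityMeasure μ] {A : Set ℝ}
    (hA : MeasurableSet A) (t : ℝ) : MemLp (A.indicator (wave t)) 2 μ := by
  refine MemLp.indicator hA (MemLp.of_bound (continuous_wave t).aestronglyMeasurable 1 ?_)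
  exact ae_of_all _ fun x => (norm_wave t x).le

/-- Generalized eigenfunctions of an evolution with the matrix elements `∫ e^{-i(t-s)x} dμ`. -/
theorem exists_eigenfunctions {ι : Type*} (μ : Measure ℝ)
    [IsProbabilityMeasure μ] (ψ : ℝ → lp (fun _ : ι => ℂ) 2)
    (h : ∀ s t, inner ℂ (ψ s) (ψ t) = ∫ x, conj (wave s x) * wave t x ∂μ) :
    ∃ u : ι → ℝ → ℂ, (∀ n, MemLp (u n) 2 μ) ∧
      (∀ t n, ψ t n = ∫ x, conj (u n x) * wave t x ∂μ) ∧
      (∀ n (S : Finset ι), ∑ m ∈ S, ‖∫ x, conj (u m x) * u n x ∂μ‖ ^ 2 ≤ 1) ∧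
      ∀ A, MeasurableSet A → ∀ t, ∃ f : lp (fun _ : ι => ℂ) 2,
        (∀ n, f n = ∫ x in A, conj (u n x) * wave t x ∂μ) ∧ ‖f‖ ^ 2 ≤ μ.real A ∧
        inner ℂ f (ψ t) = μ.real A := by
  classical
  let e : Set ℝ → ℝ → Lp ℂ 2 μ := fun A t =>
    if hA : MeasurableSet A then (memLp_indicator_wave μ hA t).toLp else 0
  have he : ∀ A, MeasurableSet A → ∀ t, e A t =ᵐ[μ] A.indicator (wave t) := by
    intro A hA t
    simp only [e, dif_pos hA]
    exact MemLp.coeFn_toLp _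
  have heu : ∀ t, e Set.univ t =ᵐ[μ] wave t := by
    intro t; simpa using he _ MeasurableSet.univ t
  have hin : ∀ (f g : Lp ℂ 2 μ) (f' g' : ℝ → ℂ), f =ᵐ[μ] f' → g =ᵐ[μ] g' →
      inner ℂ f g = ∫ x, conj (f' x) * g' x ∂μ := by
    intro f g f' g' hf hg
    rw [L2.inner_def]
    refine integral_congr_ae ?_
    filter_upwards [hf, hg] with x h1 h2
    rw [RCLike.inner_apply, h1, h2, mul_comm]
  obtain ⟨W, hW, hW1, hW2⟩ := exists_partialIsometry (e Set.univ) ψ (fun s t => by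
    rw [h, hin _ _ _ _ (heu s) (heu t)])
  let u : ι → Lp ℂ 2 μ := fun n => ContinuousLinearMap.adjoint W (lp.single 2 n 1)
  have hu : ∀ n f, inner ℂ (u n) f = W f n := by
    intro n f
    rw [ContinuousLinearMap.adjoint_inner_left, lp.inner_single_left]
    simp
  have hS : ∀ (v : lp (fun _ : ι => ℂ) 2) (S : Finset ι), ∑ m ∈ S, ‖v m‖ ^ 2 ≤ ‖v‖ ^ 2 := by
    intro v S
    simpa using lp.sum_rpow_le_norm_rpow (p := 2) (by simp) v S
  refine ⟨fun n => u n, fun n => Lp.memLp _, ?_, ?_, ?_⟩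
  · intro t n
    rw [← hin _ _ _ _ EventuallyEq.rfl (heu t), hu, hW]
  · intro n S
    -- A column of the Gram matrix lists the coordinates of `W W* δ_n`, a vector of norm at most
    -- `1`.
    have h1 : ∀ m, ∫ x, conj (u m x) * u n x ∂μ = W (u n) m := by
      intro m
      rw [← hin (u m) (u n) _ _ EventuallyEq.rfl EventuallyEq.rfl, hu]
    simp only [h1]
    refine (hS _ S).trans ?_
    have hun : ‖u n‖ ≤ 1 := by
      have hop : ‖ContinuousLinearMap.adjoint W‖ ≤ 1 := by
        rw [LinearIsometryEquiv.norm_map]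
        exact W.opNorm_le_bound zero_le_one fun x => by simpa using hW1 x
      refine ((ContinuousLinearMap.adjoint W).le_of_opNorm_le hop _).trans ?_
      rw [lp.norm_single]
      · simp
      · simp
    have := (hW1 (u n)).trans hun
    exact pow_le_one₀ (norm_nonneg _) this
  · intro A hA t
    -- This vector plays the role of the spectral projection to `A` applied to `ψ t`.
    refine ⟨W (e A t), ?_, ?_, ?_⟩
    · intro n
      rw [← hu, hin _ _ _ _ EventuallyEq.rfl (he A hA t), ← integral_indicator hA]
      congr 1; ext x
      by_cases hx : x ∈ A <;> simp [hx]
    · have h1 : ‖W (e A t)‖ ^ 2 ≤ ‖e A t‖ ^ 2 := by gcongr; exact hW1 _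
      refine h1.trans (le_of_eq ?_)
      have h2 : ((‖e A t‖ ^ 2 : ℝ) : ℂ) = μ.real A := by
        push_cast
        rw [← Complex.coe_algebraMap, ← inner_self_eq_norm_sq_to_K, hin _ _ _ _ (he A hA t) (he A hA t)]
        have : (fun x => conj (A.indicator (wave t) x) * A.indicator (wave t) x) =
            A.indicator fun _ => (1 : ℂ) := by
          ext x
          by_cases hx : x ∈ A
          · simp [hx, conj_wave_mul_self]
          · simp [hx]
        rw [this, integral_indicator hA]; simp
      exact_mod_cast h2
    -- The adjoint takes `ψ t` back to the full character, so the overlap is computed in `L²(μ)`.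
    · rw [← ContinuousLinearMap.adjoint_inner_right, hW2, hin _ _ _ _ (he A hA t) (heu t)]
      have : (fun x => conj (A.indicator (wave t) x) * wave t x) =
          A.indicator fun _ => (1 : ℂ) := by
        ext x
        by_cases hx : x ∈ A
        · simp [hx, conj_wave_mul_self]
        · simp [hx]
      rw [this, integral_indicator hA]; simp

/-! ### Time averages and the probability carried by a finite set of sites. -/

/-- The average of `e^{-itw}` over the times `t`. -/
noncomputable def avgWave (ρ : Measure ℝ) (w : ℝ) : ℂ := ∫ t, wave t w ∂ρ

theorem norm_avgWave_le (ρ : Measure ℝ) [IsProbabilityMeasure ρ] (w : ℝ) :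
    ‖avgWave ρ w‖ ≤ 1 := by
  refine (norm_integral_le_of_norm_le_const (C := 1) (ae_of_all _ fun t => ?_)).trans (by simp)
  exact (norm_wave t w).le

theorem continuous_avgWave (ρ : Measure ℝ) [IsProbabilityMeasure ρ] :
    Continuous (avgWave ρ) := by
  refine continuous_of_dominated (bound := fun _ => 1) ?_ ?_ (integrable_const _) ?_
  · intro w
    exact (continuous_wave_uncurry.comp
      (continuous_id.prodMk continuous_const)).aestronglyMeasurable
  · exact fun w => ae_of_all _ fun t => (norm_wave t w).le
  · exact ae_of_all _ fun t => continuous_wave t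

/-- Fubini moves the time average inside the energy integrals, where only the difference of the
energies matters. Two measures are needed because one factor will be restricted to `A`. -/
theorem integral_conj_mul_wave (ρ μ₁ μ₂ : Measure ℝ) [IsProbabilityMeasure ρ]
    [IsFiniteMeasure μ₁] [IsFiniteMeasure μ₂] {a b : ℝ → ℂ} (ha : Integrable a μ₁)
    (hb : Integrable b μ₂) :
    Integrable (fun t => conj (∫ x, conj (a x) * wave t x ∂μ₁) *
      ∫ y, conj (b y) * wave t y ∂μ₂) ρ ∧
    ∫ t, conj (∫ x, conj (a x) * wave t x ∂μ₁) * ∫ y, conj (b y) * wave t y ∂μ₂ ∂ρ =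
      ∫ z, a z.1 * conj (b z.2) * avgWave ρ (z.2 - z.1) ∂(μ₁.prod μ₂) := by
  have hb' : Integrable (fun y => conj (b y)) μ₂ :=
    (LinearIsometryEquiv.integrable_comp_iff RCLike.conjLIE).2 hb
  have hab : Integrable (fun z : ℝ × ℝ => a z.1 * conj (b z.2)) (μ₁.prod μ₂) := ha.mul_prod hb'
  have hprod : Integrable (Function.uncurry fun (t : ℝ) (z : ℝ × ℝ) =>
      a z.1 * conj (b z.2) * wave t (z.2 - z.1)) (ρ.prod (μ₁.prod μ₂)) := by
    have h1 : Integrable (fun q : ℝ × (ℝ × ℝ) => (1 : ℂ) * (a q.2.1 * conj (b q.2.2)))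
        (ρ.prod (μ₁.prod μ₂)) := (integrable_const (1 : ℂ)).mul_prod hab
    simp only [one_mul] at h1
    refine h1.mul_bdd (c := 1) ?_ (ae_of_all _ fun q => (norm_wave _ _).le)
    exact (continuous_wave_uncurry.comp (f := fun q : ℝ × (ℝ × ℝ) => (q.1, q.2.2 - q.2.1))
      (by fun_prop)).aestronglyMeasurable
  have heq : ∀ t, conj (∫ x, conj (a x) * wave t x ∂μ₁) * ∫ y, conj (b y) * wave t y ∂μ₂ =
      ∫ z, a z.1 * conj (b z.2) * wave t (z.2 - z.1) ∂(μ₁.prod μ₂) := by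
    intro t
    rw [← integral_conj, ← integral_prod_mul]
    congr 1; ext z
    rw [← conj_wave_mul_wave' t, map_mul, Complex.conj_conj]
    ring
  simp only [heq]
  refine ⟨hprod.integral_prod_left, ?_⟩
  rw [integral_integral_swap hprod]
  simp only [integral_const_mul, avgWave]

theorem norm_sub_sum_single_sq {ι : Type*} [DecidableEq ι] (v : lp (fun _ : ι => ℂ) 2)
    (S : Finset ι) :
    ‖v - ∑ n ∈ S, lp.single 2 n (v n)‖ ^ 2 = ‖v‖ ^ 2 - ∑ n ∈ S, ‖v n‖ ^ 2 := by
  simpa using lp.norm_compl_sum_single (p := 2) (by simp) v S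

/-- The squared Hilbert–Schmidt norm of `∑ |u_n⟩⟨u_n|`, computed by expanding the square and
separating variables. With the row bound on the Gram matrix it is at most the number of sites. -/
theorem integral_norm_sum_mul_conj_sq {ι : Type*} (μ : Measure ℝ) [IsProbabilityMeasure μ]
    {u : ι → ℝ → ℂ} (hu : ∀ n, MemLp (u n) 2 μ) (S : Finset ι) :
    Integrable (fun z : ℝ × ℝ => ‖∑ n ∈ S, u n z.1 * conj (u n z.2)‖ ^ 2) (μ.prod μ) ∧
    ∫ z : ℝ × ℝ, ‖∑ n ∈ S, u n z.1 * conj (u n z.2)‖ ^ 2 ∂(μ.prod μ) =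
      ∑ n ∈ S, ∑ m ∈ S, ‖∫ x, conj (u m x) * u n x ∂μ‖ ^ 2 := by
  have hc : ∀ n m, Integrable (fun x => conj (u m x) * u n x) μ := fun n m =>
    MemLp.integrable_mul (p := 2) (q := 2) (hu m).star (hu n)
  have hpt : ∀ z : ℝ × ℝ, ((‖∑ n ∈ S, u n z.1 * conj (u n z.2)‖ ^ 2 : ℝ) : ℂ) =
      ∑ n ∈ S, ∑ m ∈ S, (conj (u m z.1) * u n z.1) * (conj (u n z.2) * u m z.2) := by
    intro z
    push_cast
    rw [← Complex.mul_conj', map_sum, Finset.sum_mul_sum]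
    refine Finset.sum_congr rfl fun n _ => Finset.sum_congr rfl fun m _ => ?_
    simp only [map_mul, Complex.conj_conj]; ring
  have hi : ∀ n m, Integrable (fun z : ℝ × ℝ =>
      (conj (u m z.1) * u n z.1) * (conj (u n z.2) * u m z.2)) (μ.prod μ) :=
    fun n m => (hc n m).mul_prod (hc m n)
  have hI : Integrable (fun z : ℝ × ℝ =>
      ((‖∑ n ∈ S, u n z.1 * conj (u n z.2)‖ ^ 2 : ℝ) : ℂ)) (μ.prod μ) := by
    simp only [hpt]
    exact integrable_finsetSum _ fun n _ => integrable_finsetSum _ fun m _ => hi n m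
  refine ⟨by simpa only [RCLike.re_to_complex, Complex.ofReal_re] using hI.re, ?_⟩
  have h : ((∫ z : ℝ × ℝ, ‖∑ n ∈ S, u n z.1 * conj (u n z.2)‖ ^ 2 ∂(μ.prod μ) : ℝ) : ℂ) =
      ((∑ n ∈ S, ∑ m ∈ S, ‖∫ x, conj (u m x) * u n x ∂μ‖ ^ 2 : ℝ) : ℂ) := by
    rw [← integral_complex_ofReal]
    simp only [hpt]
    rw [integral_finsetSum _ fun n _ => integrable_finsetSum _ fun m _ => hi n m]
    push_cast
    refine Finset.sum_congr rfl fun n _ => ?_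
    rw [integral_finsetSum _ fun m _ => hi n m]
    refine Finset.sum_congr rfl fun m _ => ?_
    rw [integral_prod_mul (fun x => conj (u m x) * u n x) (fun y => conj (u n y) * u m y),
      ← Complex.mul_conj', ← integral_conj]
    simp only [map_mul, Complex.conj_conj, mul_comm]
  exact_mod_cast h

/-- If the averaged kernel is small on `A × ℝ`, then a finite set of sites carries on average at
most the probability `1 - μ(A) / 4`. -/
theorem sum_integral_norm_sq_le {ι : Type*} (μ ρ : Measure ℝ) [IsProbabilityMeasure μ]
    [IsProbabilityMeasure ρ] (ψ : ℝ → lp (fun _ : ι => ℂ) 2)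
    (h : ∀ s t, inner ℂ (ψ s) (ψ t) = ∫ x, conj (wave s x) * wave t x ∂μ)
    {A : Set ℝ} (hA : MeasurableSet A) (hμA : 0 < μ.real A) (S : Finset ι) {ν : ℝ}
    (hν : 0 < ν) (hS : (S.card : ℝ) ≤ ν)
    (hJ : ν * ∫ z : ℝ × ℝ, ‖avgWave ρ (z.2 - z.1)‖ ^ 2 ∂((μ.restrict A).prod μ) ≤
      μ.real A ^ 2 / 4) :
    ∑ n ∈ S, ∫ t, ‖ψ t n‖ ^ 2 ∂ρ ≤ 1 - μ.real A / 4 := by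
  classical
  obtain ⟨u, hu, hψ, hgram, hf⟩ := exists_eigenfunctions μ ψ h
  choose f hfn hfnorm hfψ using hf A hA
  have hu1 : ∀ n, Integrable (u n) μ := fun n => (hu n).integrable (by norm_num)
  have hψ1 : ∀ t, ‖ψ t‖ ^ 2 = 1 := by
    intro t
    have h1 : ((‖ψ t‖ ^ 2 : ℝ) : ℂ) = 1 := by
      push_cast
      rw [← Complex.coe_algebraMap, ← inner_self_eq_norm_sq_to_K, h]
      simp [conj_wave_mul_self]
    exact_mod_cast h1
  have hψi : ∀ n, Integrable (fun t => ‖ψ t n‖ ^ 2) ρ := by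
    intro n
    have h1 := (integral_conj_mul_wave ρ μ μ (hu1 n) (hu1 n)).1.norm
    refine h1.congr (ae_of_all _ fun t => ?_)
    simp only [← hψ, norm_mul, RCLike.norm_conj, sq]
  have hD := fun n => integral_conj_mul_wave ρ (μ.restrict A) μ (hu1 n).restrict (hu1 n)
  -- The left side is the overlap of `f t` with the part `v` of `ψ t` outside `S`. It is estimated
  -- by Cauchy–Schwarz and `ab ≤ a²/4 + b²`, using `‖f t‖ ^ 2 ≤ μ(A)`.
  have hpt : ∀ t, μ.real A - (∑ n ∈ S, conj (f t n) * ψ t n).re ≤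
      μ.real A / 4 + (1 - ∑ n ∈ S, ‖ψ t n‖ ^ 2) := by
    intro t
    set v := ψ t - ∑ n ∈ S, lp.single 2 n (ψ t n)
    have h1 : inner ℂ (f t) v = (μ.real A : ℂ) - ∑ n ∈ S, conj (f t n) * ψ t n := by
      rw [inner_sub_right, hfψ, inner_sum]
      congr 1
      refine Finset.sum_congr rfl fun n _ => ?_
      rw [lp.inner_single_right, RCLike.inner_apply, mul_comm]
    have h2 : ‖v‖ ^ 2 = 1 - ∑ n ∈ S, ‖ψ t n‖ ^ 2 := by
      rw [norm_sub_sum_single_sq, hψ1]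
    have h3 : (inner ℂ (f t) v).re ≤ ‖f t‖ * ‖v‖ :=
      (Complex.re_le_norm _).trans (norm_inner_le_norm _ _)
    rw [h1, Complex.sub_re, Complex.ofReal_re] at h3
    nlinarith [sq_nonneg (‖f t‖ / 2 - ‖v‖), hfnorm t]
  have hDi : Integrable (fun t => ∑ n ∈ S, conj (f t n) * ψ t n) ρ := by
    refine integrable_finsetSum _ fun n _ => ?_
    simp only [hfn, hψ]
    exact (hD n).1
  have hGi : Integrable (fun t => ∑ n ∈ S, ‖ψ t n‖ ^ 2) ρ :=
    integrable_finsetSum S fun n _ => hψi n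
  have hint : ∫ t, (μ.real A - RCLike.re (∑ n ∈ S, conj (f t n) * ψ t n)) ∂ρ ≤
      ∫ t, (μ.real A / 4 + 1 - ∑ n ∈ S, ‖ψ t n‖ ^ 2) ∂ρ :=
    integral_mono ((integrable_const _).sub hDi.re) ((integrable_const _).sub hGi)
      fun t => (hpt t).trans_eq (add_sub_assoc _ _ _).symm
  rw [integral_sub (integrable_const _) hDi.re, integral_sub (integrable_const _) hGi,
    integral_finsetSum S fun n _ => hψi n] at hint
  simp only [integral_const, probReal_univ, one_smul] at hint
  -- The overlap on `S` takes at most half of `μ(A)`. With the `μ(A) / 4` lost in `hpt`, a quarter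
  -- remains for the outside.
  have hre : ∫ t, RCLike.re (∑ n ∈ S, conj (f t n) * ψ t n) ∂ρ ≤ μ.real A / 2 := by
    set σ := (μ.restrict A).prod μ
    let k : ℝ × ℝ → ℂ := fun z => ∑ n ∈ S, u n z.1 * conj (u n z.2)
    have hu2 : ∀ n, Integrable (fun y => conj (u n y)) μ := fun n =>
      (LinearIsometryEquiv.integrable_comp_iff RCLike.conjLIE).2 (hu1 n)
    have hr : Continuous fun z : ℝ × ℝ => avgWave ρ (z.2 - z.1) :=
      (continuous_avgWave ρ).comp (by fun_prop)
    have hki : ∀ n, Integrable (fun z : ℝ × ℝ =>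
        u n z.1 * conj (u n z.2) * avgWave ρ (z.2 - z.1)) σ := fun n =>
      ((hu1 n).restrict.mul_prod (hu2 n)).mul_bdd (c := 1) hr.aestronglyMeasurable
        (ae_of_all _ fun z => norm_avgWave_le ρ _)
    have h1 : ∫ t, ∑ n ∈ S, conj (f t n) * ψ t n ∂ρ = ∫ z, k z * avgWave ρ (z.2 - z.1) ∂σ := by
      rw [integral_finsetSum _ fun n _ => ?_]
      · simp only [hfn, hψ, (hD _).2, k, Finset.sum_mul]
        rw [integral_finsetSum _ fun n _ => hki n]
      · simp only [hfn, hψ]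
        exact (hD n).1
    rw [integral_re hDi, h1]
    obtain ⟨hk1, hk2⟩ := integral_norm_sum_mul_conj_sq μ hu S
    -- The Gram bound holds over all of `μ`, so `‖k‖ ^ 2` is enlarged to the full product; the
    -- averaged kernel keeps its restriction to `A`.
    have hσ : σ ≤ μ.prod μ := Measure.prod_mono Measure.restrict_le_self le_rfl
    have hk3 : ∫ z, ‖k z‖ ^ 2 ∂σ ≤ ν := by
      refine (integral_mono_measure hσ (ae_of_all _ fun z => by positivity) hk1).trans ?_
      rw [hk2]
      refine (Finset.sum_le_sum fun n _ => hgram n S).trans ?_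
      simpa using hS
    have hri : Integrable (fun z : ℝ × ℝ => ‖avgWave ρ (z.2 - z.1)‖ ^ 2) σ := by
      refine Integrable.of_bound (hr.norm.pow 2).aestronglyMeasurable 1 (ae_of_all _ fun z => ?_)
      rw [norm_pow, norm_norm]
      exact pow_le_one₀ (norm_nonneg _) (norm_avgWave_le ρ _)
    have hk1' := hk1.mono_measure hσ
    set J := ∫ z : ℝ × ℝ, ‖avgWave ρ (z.2 - z.1)‖ ^ 2 ∂σ
    set m := μ.real A
    -- Weighted AM–GM, with the weights chosen so that each term contributes at most `m / 4`.
    have h2 : ‖∫ z, k z * avgWave ρ (z.2 - z.1) ∂σ‖ ≤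
        ∫ z, (m / (4 * ν) * ‖k z‖ ^ 2 + ν / m * ‖avgWave ρ (z.2 - z.1)‖ ^ 2) ∂σ := by
      refine norm_integral_le_of_norm_le ((hk1'.const_mul _).add (hri.const_mul _))
        (ae_of_all _ fun z => ?_)
      rw [norm_mul]
      have h3 : m / (4 * ν) * ‖k z‖ ^ 2 + ν / m * ‖avgWave ρ (z.2 - z.1)‖ ^ 2 -
          ‖k z‖ * ‖avgWave ρ (z.2 - z.1)‖ =
          (m * ‖k z‖ - 2 * ν * ‖avgWave ρ (z.2 - z.1)‖) ^ 2 / (4 * ν * m) := by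
        field_simp; ring
      have h4 : 0 ≤ (m * ‖k z‖ - 2 * ν * ‖avgWave ρ (z.2 - z.1)‖) ^ 2 / (4 * ν * m) := by
        positivity
      linarith
    rw [integral_add (hk1'.const_mul _) (hri.const_mul _), integral_const_mul,
      integral_const_mul] at h2
    refine (RCLike.re_le_norm _).trans (h2.trans ?_)
    have h5 : m / (4 * ν) * ∫ z, ‖k z‖ ^ 2 ∂σ ≤ m / 4 := by
      calc m / (4 * ν) * ∫ z, ‖k z‖ ^ 2 ∂σ ≤ m / (4 * ν) * ν := by gcongr
        _ = m / 4 := by field_simp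
    have h6 : ν / m * J ≤ m / 4 := by
      calc ν / m * J = (ν * J) / m := by ring
        _ ≤ (m ^ 2 / 4) / m := by gcongr
        _ = m / 4 := by field_simp
    linarith
  linarith

/-! ### Poisson kernels and the energy integral. -/

/-- The Poisson kernel, up to the factor `π`. -/
noncomputable def poisson (ε E x : ℝ) : ℝ := ε / ((x - E) ^ 2 + ε ^ 2)

theorem poisson_nonneg {ε : ℝ} (hε : 0 < ε) (E x : ℝ) : 0 ≤ poisson ε E x := by
  unfold poisson; positivity

theorem poisson_le {ε : ℝ} (hε : 0 < ε) (E x : ℝ) : poisson ε E x ≤ 1 / ε := by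
  unfold poisson
  rw [div_le_div_iff₀ (by positivity) hε]
  nlinarith [sq_nonneg (x - E)]

theorem continuous_poisson {ε : ℝ} (hε : 0 < ε) :
    Continuous fun z : ℝ × ℝ => poisson ε z.1 z.2 := by
  unfold poisson
  exact continuous_const.div (by fun_prop) fun z => by positivity

theorem integrable_poisson {ε : ℝ} (hε : 0 < ε) (E : ℝ) (μ : Measure ℝ) [IsFiniteMeasure μ] :
    Integrable (poisson ε E) μ := by
  refine Integrable.of_bound ((continuous_poisson hε).comp
    (continuous_const.prodMk continuous_id)).aestronglyMeasurable (1 / ε) (ae_of_all _ fun x => ?_)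
  rw [Real.norm_of_nonneg (poisson_nonneg hε E x)]
  exact poisson_le hε E x

theorem integrable_integral_poisson {ε : ℝ} (hε : 0 < ε) (μ : Measure ℝ) [IsFiniteMeasure μ] :
    Integrable fun E => ∫ x, poisson ε E x ∂μ := by
  have hk : Integrable fun y : ℝ => ε / (y ^ 2 + ε ^ 2) := by
    have h := ((integrable_inv_one_add_sq.comp_div hε.ne').const_mul (1 / ε))
    refine h.congr (ae_of_all _ fun y => ?_)
    simp only
    field_simp
    ring
  have hE : ∀ x, Integrable fun E => poisson ε E x := fun x => hk.comp_sub_left x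
  have h : Integrable (Function.uncurry (poisson ε)) (volume.prod μ) := by
    refine (integrable_prod_iff' (continuous_poisson hε).aestronglyMeasurable).2
      ⟨ae_of_all _ hE, ?_⟩
    have : ∀ x, ∫ E, ‖Function.uncurry (poisson ε) (E, x)‖ = ∫ y, ε / (y ^ 2 + ε ^ 2) := by
      intro x
      rw [← integral_sub_left_eq_self (fun y => ε / (y ^ 2 + ε ^ 2)) volume x]
      congr 1; ext E
      exact Real.norm_of_nonneg (poisson_nonneg hε E x)
    exact (integrable_const (∫ y, ε / (y ^ 2 + ε ^ 2))).congr (ae_of_all _ fun x => (this x).symm)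
  exact h.integral_prod_left

/-- An integrable function bounded by `1 / ε` has an integrable square. Without this the Bochner
integral in `energyIntegral` could take its default value `0` and carry no information. -/
theorem integrable_integral_poisson_sq {ε : ℝ} (hε : 0 < ε) (μ : Measure ℝ)
    [IsProbabilityMeasure μ] : Integrable fun E => (∫ x, poisson ε E x ∂μ) ^ 2 := by
  have h := integrable_integral_poisson hε μ
  simp only [sq]
  refine h.mul_bdd (c := 1 / ε) h.aestronglyMeasurable (ae_of_all _ fun E => ?_)
  refine (norm_integral_le_of_norm_le_const (C := 1 / ε) (ae_of_all _ fun x => ?_)).trans (by simp)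
  rw [Real.norm_of_nonneg (poisson_nonneg hε E x)]
  exact poisson_le hε E x

/-- Energies within `ε` of `x` already suffice, and they lie in the thickening because `x ∈ A`. -/
theorem le_lintegral_poisson_mul {ε : ℝ} (hε : 0 < ε) {A : Set ℝ} {x : ℝ} (hx : x ∈ A) (y : ℝ) :
    ENNReal.ofReal (4 * ε ^ 2 / (4 * ε ^ 2 + (y - x) ^ 2)) ≤
      ENNReal.ofReal (8 * ε) * ∫⁻ E in Metric.thickening (2 * ε) A,
        ENNReal.ofReal (poisson ε E x) * ENNReal.ofReal (poisson ε E y) := by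
  -- For `|E - x| < ε` the first factor bounds the kernel at `x` from below. The second does so at
  -- `y`, by `(y - E)² ≤ 2(y - x)² + 2(E - x)²`. The doubled `(y - x)²` is what requires the factor
  -- `8`.
  set c := 1 / (2 * ε) * (ε / (3 * ε ^ 2 + 2 * (y - x) ^ 2)) with hc
  have hball : Metric.ball x ε ⊆ Metric.thickening (2 * ε) A := by
    intro E hE
    rw [Metric.mem_thickening_iff]
    exact ⟨x, hx, (Metric.mem_ball.1 hE).trans (by linarith)⟩
  have hlow : ∀ E ∈ Metric.ball x ε, ENNReal.ofReal c ≤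
      ENNReal.ofReal (poisson ε E x) * ENNReal.ofReal (poisson ε E y) := by
    intro E hE
    rw [← ENNReal.ofReal_mul (poisson_nonneg hε E x)]
    refine ENNReal.ofReal_le_ofReal ?_
    have hd : (E - x) ^ 2 ≤ ε ^ 2 := by
      rw [Metric.mem_ball, Real.dist_eq] at hE
      exact sq_le_sq' (by linarith [(abs_lt.1 hE).1]) (abs_lt.1 hE).2.le
    rw [hc]
    refine mul_le_mul ?_ ?_ (by positivity) (poisson_nonneg hε E x)
    · unfold poisson
      rw [div_le_div_iff₀ (by positivity) (by positivity)]
      nlinarith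
    · unfold poisson
      refine div_le_div_of_nonneg_left hε.le (by positivity) ?_
      nlinarith [sq_nonneg (y - x + (E - x))]
  calc ENNReal.ofReal (4 * ε ^ 2 / (4 * ε ^ 2 + (y - x) ^ 2))
      ≤ ENNReal.ofReal (8 * ε * (c * (2 * ε))) := by
        refine ENNReal.ofReal_le_ofReal ?_
        have : 8 * ε * (c * (2 * ε)) = 8 * ε ^ 2 / (3 * ε ^ 2 + 2 * (y - x) ^ 2) := by
          rw [hc]; field_simp
        rw [this, div_le_div_iff₀ (by positivity) (by positivity)]
        nlinarith [mul_pos (pow_pos hε 2) (pow_pos hε 2)]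
    _ = ENNReal.ofReal (8 * ε) * ∫⁻ _ in Metric.ball x ε, ENNReal.ofReal c := by
        rw [setLIntegral_const, Real.volume_ball, ← ENNReal.ofReal_mul (by positivity),
          ← ENNReal.ofReal_mul (by positivity)]
    _ ≤ _ := by
        gcongr ENNReal.ofReal (8 * ε) * ?_
        exact (setLIntegral_mono' Metric.isOpen_ball.measurableSet hlow).trans
          (lintegral_mono_set hball)

/-- The pointwise bound is integrated and Tonelli separates the two energies. Dropping the
restriction to `A` in one factor leaves a perfect square; the set survives only through its
thickening. -/
theorem integral_kernel_le {ε : ℝ} (hε : 0 < ε) (μ : Measure ℝ) [IsProbabilityMeasure μ]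
    {A : Set ℝ} (hA : MeasurableSet A) :
    ∫ z : ℝ × ℝ, 4 * ε ^ 2 / (4 * ε ^ 2 + (z.2 - z.1) ^ 2) ∂((μ.restrict A).prod μ) ≤
      8 * (ε * ∫ E in Metric.thickening (2 * ε) A, (∫ x, poisson ε E x ∂μ) ^ 2) := by
  have hnn : 0 ≤ ∫ E in Metric.thickening (2 * ε) A, (∫ x, poisson ε E x ∂μ) ^ 2 :=
    integral_nonneg fun E => by positivity
  have hcont : Continuous fun z : ℝ × ℝ => 4 * ε ^ 2 / (4 * ε ^ 2 + (z.2 - z.1) ^ 2) :=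
    continuous_const.div (by fun_prop) fun z => by positivity
  rw [integral_eq_lintegral_of_nonneg_ae (ae_of_all _ fun z => by positivity)
    hcont.aestronglyMeasurable]
  refine ENNReal.toReal_le_of_le_ofReal (by positivity) ?_
  have hof : ∀ E, ENNReal.ofReal (∫ x, poisson ε E x ∂μ) =
      ∫⁻ x, ENNReal.ofReal (poisson ε E x) ∂μ := fun E =>
    ofReal_integral_eq_lintegral_ofReal (integrable_poisson hε E μ)
      (ae_of_all _ (poisson_nonneg hε E))
  have hq : ∀ E, 0 ≤ ∫ x, poisson ε E x ∂μ := fun E => integral_nonneg (poisson_nonneg hε E)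
  have hmeas : ∀ E, Measurable fun x => ENNReal.ofReal (poisson ε E x) := fun E =>
    ((continuous_poisson hε).comp (continuous_const.prodMk continuous_id)).measurable.ennreal_ofReal
  have hmeas2 : Measurable (Function.uncurry fun (z : ℝ × ℝ) (E : ℝ) =>
      ENNReal.ofReal (poisson ε E z.1) * ENNReal.ofReal (poisson ε E z.2)) := by
    change Measurable fun q : (ℝ × ℝ) × ℝ =>
      ENNReal.ofReal (poisson ε q.2 q.1.1) * ENNReal.ofReal (poisson ε q.2 q.1.2)
    refine Measurable.fun_mul ?_ ?_
    · exact ((continuous_poisson hε).comp (f := fun q : (ℝ × ℝ) × ℝ => (q.2, q.1.1))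
        (by fun_prop)).measurable.ennreal_ofReal
    · exact ((continuous_poisson hε).comp (f := fun q : (ℝ × ℝ) × ℝ => (q.2, q.1.2))
        (by fun_prop)).measurable.ennreal_ofReal
  have hAe : ∀ᵐ z ∂((μ.restrict A).prod μ), z.1 ∈ A :=
    Measure.quasiMeasurePreserving_fst.ae (ae_restrict_mem hA)
  calc ∫⁻ z, ENNReal.ofReal (4 * ε ^ 2 / (4 * ε ^ 2 + (z.2 - z.1) ^ 2)) ∂((μ.restrict A).prod μ)
      ≤ ∫⁻ z, (ENNReal.ofReal (8 * ε) * ∫⁻ E in Metric.thickening (2 * ε) A,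
          ENNReal.ofReal (poisson ε E z.1) * ENNReal.ofReal (poisson ε E z.2))
            ∂((μ.restrict A).prod μ) := by
        refine lintegral_mono_ae ?_
        filter_upwards [hAe] with z hz using le_lintegral_poisson_mul hε hz z.2
    _ = ENNReal.ofReal (8 * ε) * ∫⁻ E in Metric.thickening (2 * ε) A,
          (∫⁻ x in A, ENNReal.ofReal (poisson ε E x) ∂μ) *
            ∫⁻ x, ENNReal.ofReal (poisson ε E x) ∂μ := by
        rw [lintegral_const_mul' _ _ ENNReal.ofReal_ne_top,
          lintegral_lintegral_swap hmeas2.aemeasurable]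
        congr 1
        refine lintegral_congr fun E => ?_
        exact lintegral_prod_mul (hmeas E).aemeasurable (hmeas E).aemeasurable
    _ ≤ ENNReal.ofReal (8 * ε) * ∫⁻ E in Metric.thickening (2 * ε) A,
          ENNReal.ofReal ((∫ x, poisson ε E x ∂μ) ^ 2) := by
        gcongr with E
        rw [ENNReal.ofReal_pow (hq E), hof, sq]
        gcongr
        exact Measure.restrict_le_self
    _ = _ := by
        rw [← ofReal_integral_eq_lintegral_ofReal
          (integrable_integral_poisson_sq hε μ).integrableOn (ae_of_all _ fun E => by positivity),
          ← ENNReal.ofReal_mul (by positivity), mul_assoc]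

theorem im_borelTransform {d : Domain} (V : d.sites → ℝ) {ε : ℝ} (hε : 0 < ε) (E : ℝ) :
    (borelTransform V (E + Complex.I * ε)).im = ∫ x, poisson ε E x ∂(spectralMeasure V) := by
  have := (spectralMeasure_spec V).1
  have him : ∀ x : ℝ, (1 / ((x : ℂ) - (E + Complex.I * ε))).im = poisson ε E x := by
    intro x
    rw [one_div, Complex.inv_im, Complex.normSq_apply]
    simp [poisson, sq]
  have hne : ∀ x : ℝ, (x : ℂ) - (E + Complex.I * ε) ≠ 0 := by
    intro x h0
    have := congrArg Complex.im h0
    simp at this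
    exact hε.ne' this
  have hi : Integrable (fun x : ℝ => 1 / ((x : ℂ) - (E + Complex.I * ε))) (spectralMeasure V) := by
    refine Integrable.of_bound (continuous_const.div (by fun_prop) hne).aestronglyMeasurable
      (1 / ε) (ae_of_all _ fun x => ?_)
    rw [norm_div, norm_one]
    refine one_div_le_one_div_of_le hε ?_
    have := Complex.abs_im_le_norm ((x : ℂ) - (E + Complex.I * ε))
    simpa [abs_of_pos hε] using this
  rw [borelTransform, ← RCLike.im_eq_complex_im, ← integral_im hi]
  exact integral_congr_ae (ae_of_all _ him)

/-! ### The exponential law of the times. -/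

/-- The exponential distribution of the times, with mean `T / 2`. -/
noncomputable def timeMeasure (T : ℝ) : Measure ℝ := ProbabilityTheory.expMeasure (2 / T)

theorem isProbabilityMeasure_timeMeasure {T : ℝ} (hT : 0 < T) :
    IsProbabilityMeasure (timeMeasure T) :=
  ProbabilityTheory.isProbabilityMeasure_expMeasure (by positivity)

theorem integral_timeMeasure {G : Type*} [NormedAddCommGroup G] [NormedSpace ℝ G] {T : ℝ}
    (hT : 0 < T) (f : ℝ → G) :
    ∫ t, f t ∂(timeMeasure T) =
      (2 / T) • ∫ t in Set.Ioi (0 : ℝ), Real.exp (-2 * t / T) • f t := by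
  have h1 : timeMeasure T = volume.withDensity (ProbabilityTheory.exponentialPDF (2 / T)) := rfl
  have hm : Measurable (ProbabilityTheory.exponentialPDF (2 / T)) :=
    (ProbabilityTheory.measurable_exponentialPDFReal _).ennreal_ofReal
  rw [h1, integral_withDensity_eq_integral_toReal_smul hm
    (ae_of_all _ fun t => ENNReal.ofReal_lt_top), ← integral_Ici_eq_integral_Ioi,
    ← integral_smul, ← integral_indicator measurableSet_Ici]
  congr 1; ext t
  rw [ProbabilityTheory.exponentialPDF_eq]
  by_cases ht : 0 ≤ t
  · have h2 : t ∈ Set.Ici (0 : ℝ) := ht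
    rw [if_pos ht, Set.indicator_of_mem h2, ENNReal.toReal_ofReal (by positivity), mul_smul]
    congr 3; ring
  · have h2 : t ∉ Set.Ici (0 : ℝ) := ht
    rw [if_neg ht, Set.indicator_of_notMem h2]
    simp

theorem avgWave_timeMeasure {T : ℝ} (hT : 0 < T) (w : ℝ) :
    avgWave (timeMeasure T) w = (2 / T : ℝ) / ((2 / T : ℝ) + Complex.I * w) := by
  have h2 : (0 : ℝ) < 2 / T := by positivity
  rw [avgWave, integral_timeMeasure hT]
  have h1 : ∀ t : ℝ, Real.exp (-2 * t / T) • wave t w =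
      Complex.exp (-((2 / T : ℝ) + Complex.I * w) * t) := by
    intro t
    rw [Complex.real_smul, wave, Complex.ofReal_exp, ← Complex.exp_add]
    congr 1; push_cast; ring
  simp only [h1]
  rw [integral_exp_mul_complex_Ioi (by simpa using h2), Complex.real_smul]
  simp only [Complex.ofReal_zero, mul_zero, Complex.exp_zero, neg_div_neg_eq]
  ring

theorem norm_sq_avgWave_timeMeasure {T : ℝ} (hT : 0 < T) (w : ℝ) :
    ‖avgWave (timeMeasure T) w‖ ^ 2 = 4 * (1 / T) ^ 2 / (4 * (1 / T) ^ 2 + w ^ 2) := by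
  rw [avgWave_timeMeasure hT, norm_div, div_pow, ← Complex.normSq_eq_norm_sq,
    ← Complex.normSq_eq_norm_sq, Complex.normSq_apply, Complex.normSq_apply]
  simp
  ring_nf

/-- For an exponential law the real part of the characteristic function equals its squared modulus.
This identifies the kernel integral over `ℝ × ℝ` with the return probability. -/
theorem re_avgWave_timeMeasure {T : ℝ} (hT : 0 < T) (w : ℝ) :
    (avgWave (timeMeasure T) w).re = 4 * (1 / T) ^ 2 / (4 * (1 / T) ^ 2 + w ^ 2) := by
  rw [avgWave_timeMeasure hT, Complex.div_re, Complex.normSq_apply]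
  simp
  ring_nf

/-! ### Averaged probabilities and lower bounds for the moments. -/

variable {d : Domain} (V : d.sites → ℝ)

theorem avgProb_eq_integral {T : ℝ} (hT : 0 < T) (n : d.sites) :
    avgProb V n T = ∫ t, ‖evolution V t n‖ ^ 2 ∂(timeMeasure T) := by
  rw [integral_timeMeasure hT]
  rfl

theorem avgProb_nonneg {T : ℝ} (hT : 0 < T) (n : d.sites) : 0 ≤ avgProb V n T := by
  rw [avgProb_eq_integral V hT]
  exact integral_nonneg fun t => by positivity

theorem norm_evolution (t : ℝ) : ‖evolution V t‖ = 1 := by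
  have := (spectralMeasure_spec V).1
  have h1 : ((‖evolution V t‖ ^ 2 : ℝ) : ℂ) = 1 := by
    push_cast
    rw [← Complex.coe_algebraMap, ← inner_self_eq_norm_sq_to_K, inner_evolution]
    simp [conj_wave_mul_self]
  have h2 : ‖evolution V t‖ ^ 2 = 1 := by exact_mod_cast h1
  exact (pow_eq_one_iff_of_nonneg (norm_nonneg _) two_ne_zero).1 h2

theorem hasSum_norm_sq_evolution (t : ℝ) : HasSum (fun n => ‖evolution V t n‖ ^ 2) 1 := by
  have h := lp.hasSum_norm (p := 2) (by simp) (evolution V t)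
  simpa [norm_evolution] using h

theorem continuous_evolution_apply (n : d.sites) : Continuous fun t => evolution V t n := by
  classical
  have h : Continuous (evolution V) := continuous_iff_continuousAt.2 fun t => by
    obtain ⟨_, h⟩ := (evolution_spec V).2 t
    exact h.continuousAt
  have h2 : Continuous fun t => inner ℂ (lp.single 2 n (1 : ℂ) : d.ell2) (evolution V t) :=
    continuous_const.inner h
  simpa [lp.inner_single_left] using h2

/-- Conservation of the norm at each time, averaged by Tonelli. -/
theorem hasSum_avgProb {T : ℝ} (hT : 0 < T) : HasSum (fun n => avgProb V n T) 1 := by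
  have := isProbabilityMeasure_timeMeasure hT
  have hle : ∀ t n, ‖evolution V t n‖ ^ 2 ≤ 1 := fun t n =>
    le_hasSum (hasSum_norm_sq_evolution V t) n fun m _ => by positivity
  have hcont : ∀ n, Continuous fun t => ‖evolution V t n‖ ^ 2 := fun n =>
    (continuous_evolution_apply V n).norm.pow 2
  have hof : ∀ n, ENNReal.ofReal (avgProb V n T) =
      ∫⁻ t, ENNReal.ofReal (‖evolution V t n‖ ^ 2) ∂(timeMeasure T) := by
    intro n
    rw [avgProb_eq_integral V hT, ofReal_integral_eq_lintegral_ofReal _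
      (ae_of_all _ fun t => by positivity)]
    refine Integrable.of_bound (hcont n).aestronglyMeasurable 1 (ae_of_all _ fun t => ?_)
    rw [Real.norm_of_nonneg (by positivity)]
    exact hle t n
  have htsum : ∑' n, ENNReal.ofReal (avgProb V n T) = 1 := by
    simp only [hof]
    rw [← lintegral_tsum fun n => (hcont n).measurable.ennreal_ofReal.aemeasurable]
    have h1 : ∀ t, ∑' n, ENNReal.ofReal (‖evolution V t n‖ ^ 2) = 1 := by
      intro t
      rw [← ENNReal.ofReal_tsum_of_nonneg (fun n => by positivity)
        (hasSum_norm_sq_evolution V t).summable, (hasSum_norm_sq_evolution V t).tsum_eq]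
      simp
    simp only [h1, lintegral_const, measure_univ, mul_one]
  have h2 := ENNReal.hasSum_toReal (f := fun n => ENNReal.ofReal (avgProb V n T))
    (by rw [htsum]; simp)
  rw [← ENNReal.tsum_toReal_eq fun n => ENNReal.ofReal_ne_top, htsum] at h2
  simpa [ENNReal.toReal_ofReal, avgProb_nonneg V hT] using h2

/-- Markov's inequality: the probability outside `S` is weighted by at least `r`. -/
theorem le_moment {p T r : ℝ} (hT : 0 < T) (S : Finset d.sites)
    (hr : ∀ n : d.sites, n ∉ S → r ≤ |((n : ℤ) : ℝ)| ^ p) :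
    ENNReal.ofReal (r * (1 - ∑ n ∈ S, avgProb V n T)) ≤ moment V p T := by
  classical
  rcases le_or_gt r 0 with h0 | h0
  · have hs : ∑ n ∈ S, avgProb V n T ≤ 1 :=
      sum_le_hasSum S (fun n _ => avgProb_nonneg V hT n) (hasSum_avgProb V hT)
    rw [ENNReal.ofReal_of_nonpos (mul_nonpos_of_nonpos_of_nonneg h0 (by linarith))]
    exact zero_le
  have h1 : HasSum (fun n => if n ∈ S then avgProb V n T else 0) (∑ n ∈ S, avgProb V n T) := by
    rw [Finset.sum_congr rfl fun n hn =>
      (if_pos hn : (if n ∈ S then avgProb V n T else 0) = avgProb V n T).symm]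
    exact hasSum_sum_of_ne_finset_zero fun n hn => if_neg hn
  have h2 := ((hasSum_avgProb V hT).sub h1).mul_left r
  have hnn : ∀ n, 0 ≤ r * (avgProb V n T - if n ∈ S then avgProb V n T else 0) := by
    intro n
    refine mul_nonneg h0.le ?_
    split_ifs
    · simp
    · simpa using avgProb_nonneg V hT n
  rw [← h2.tsum_eq, ENNReal.ofReal_tsum_of_nonneg hnn h2.summable]
  refine ENNReal.tsum_le_tsum fun n => ENNReal.ofReal_le_ofReal ?_
  split_ifs with hn
  · simpa using mul_nonneg (Real.rpow_nonneg (abs_nonneg _) _) (avgProb_nonneg V hT n)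
  · simpa using mul_le_mul_of_nonneg_right (hr n hn) (avgProb_nonneg V hT n)

/-- The sites at distance at most `k` from the origin. -/
noncomputable def nearSites (d : Domain) (k : ℕ) : Finset d.sites :=
  -- The radius `k + 1` compensates for centring at the site `1`, since `0` is not a site of the
  -- half-line.
  (near_finite d.one (k + 1)).toFinset.filter fun n => |(n : ℤ)| ≤ k

theorem mem_nearSites {k : ℕ} {n : d.sites} : n ∈ nearSites d k ↔ |(n : ℤ)| ≤ k := by
  simp only [nearSites, Finset.mem_filter, Set.Finite.mem_toFinset, Set.mem_ofPred_eq,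
    and_iff_right_iff_imp, Domain.one]
  intro h
  rw [abs_le] at *
  omega

theorem card_nearSites_le (k : ℕ) : (nearSites d k).card ≤ 2 * k + 1 := by
  have h := Finset.card_le_card_of_injOn (s := nearSites d k) (t := Finset.Icc (-(k : ℤ)) k)
    ((↑) : d.sites → ℤ) (fun n hn => by
      simpa [abs_le] using mem_nearSites.1 hn) Subtype.val_injective.injOn
  rw [Int.card_Icc] at h
  omega

theorem le_moment_of_kernel {p T : ℝ} (hp : 0 < p) (hT : 0 < T) {A : Set ℝ}
    (hA : MeasurableSet A) (hμA : 0 < (spectralMeasure V).real A) {ν : ℝ} (hν : 1 ≤ ν)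
    (hJ : ν * ∫ z : ℝ × ℝ, 4 * (1 / T) ^ 2 / (4 * (1 / T) ^ 2 + (z.2 - z.1) ^ 2)
      ∂(((spectralMeasure V).restrict A).prod (spectralMeasure V)) ≤
        (spectralMeasure V).real A ^ 2 / 4) :
    ENNReal.ofReal ((ν / 3) ^ p * ((spectralMeasure V).real A / 4)) ≤ moment V p T := by
  have := (spectralMeasure_spec V).1
  have := isProbabilityMeasure_timeMeasure hT
  -- The largest `k` with `2 * k + 1 ≤ ν`, so that the near sites number at most `ν`.
  set k := ⌊(ν - 1) / 2⌋₊
  have hk1 : (k : ℝ) ≤ (ν - 1) / 2 := Nat.floor_le (by linarith)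
  have hk2 : (ν - 1) / 2 < k + 1 := Nat.lt_floor_add_one _
  have hcard : ((nearSites d k).card : ℝ) ≤ ν := by
    have : ((nearSites d k).card : ℝ) ≤ 2 * k + 1 := by exact_mod_cast card_nearSites_le k
    linarith
  have hsum := sum_integral_norm_sq_le (spectralMeasure V) (timeMeasure T) (evolution V)
    (inner_evolution V) hA hμA (nearSites d k) (by linarith) hcard
    (by simpa only [norm_sq_avgWave_timeMeasure hT] using hJ)
  simp only [← avgProb_eq_integral V hT] at hsum
  refine le_trans (ENNReal.ofReal_le_ofReal ?_)
    (le_moment V (p := p) (r := (ν / 3) ^ p) hT (nearSites d k) fun n hn => ?_)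
  · refine mul_le_mul_of_nonneg_left (by linarith) (by positivity)
  · refine Real.rpow_le_rpow (by positivity) ?_ hp.le
    rw [mem_nearSites, not_le] at hn
    have h1 : (k : ℝ) + 1 ≤ |((n : ℤ) : ℝ)| := by
      have : (k : ℤ) + 1 ≤ |(n : ℤ)| := hn
      exact_mod_cast this
    have h2 : (0 : ℝ) ≤ k := by positivity
    -- `k + 1` exceeds `(ν - 1) / 2` and is at least `1`; weights `2/3` and `1/3` give `ν / 3`.
    linarith

theorem avgProb_one_eq {T : ℝ} (hT : 0 < T) :
    avgProb V d.one T = ∫ z : ℝ × ℝ, 4 * (1 / T) ^ 2 / (4 * (1 / T) ^ 2 + (z.2 - z.1) ^ 2)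
      ∂((spectralMeasure V).prod (spectralMeasure V)) := by
  have := (spectralMeasure_spec V).1
  have := isProbabilityMeasure_timeMeasure hT
  set μ := spectralMeasure V
  obtain ⟨hi, he⟩ := integral_conj_mul_wave (timeMeasure T) μ μ
    (integrable_const (1 : ℂ)) (integrable_const (1 : ℂ))
  simp only [map_one, one_mul] at hi he
  have hpsi : ∀ t, evolution V t d.one = ∫ x, wave t x ∂μ := (spectralMeasure_spec V).2.1
  have hpt : ∀ t, ‖evolution V t d.one‖ ^ 2 =
      RCLike.re (conj (∫ x, wave t x ∂μ) * ∫ x, wave t x ∂μ) := by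
    intro t
    rw [← hpsi, Complex.conj_mul']
    simp only [RCLike.re_to_complex, ← Complex.ofReal_pow, Complex.ofReal_re]
  rw [avgProb_eq_integral V hT]
  simp only [hpt]
  rw [integral_re hi, he, ← integral_re]
  · simp only [RCLike.re_to_complex, re_avgWave_timeMeasure hT]
  · exact Integrable.of_bound ((continuous_avgWave _).comp (by fun_prop)).aestronglyMeasurable 1
      (ae_of_all _ fun z => norm_avgWave_le _ _)

/-- On the whole line the site `0` has weight zero, so it must be excluded that nearly all the mass
sits there. Either the site `1` keeps probability above `1/4` and suffices alone, or the return
probability is small enough to apply the kernel criterion with `A = ℝ` and `ν = 1`. -/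
theorem moment_lower_bound_const {p T : ℝ} (hp : 0 < p) (hT : 0 < T) :
    ENNReal.ofReal ((1 / 3) ^ p / 4) ≤ moment V p T := by
  have := (spectralMeasure_spec V).1
  rcases le_or_gt (avgProb V d.one T) (1 / 4) with h | h
  · have h1 := le_moment_of_kernel V hp hT MeasurableSet.univ (ν := 1) (by simp) le_rfl (by
      rw [Measure.restrict_univ, ← avgProb_one_eq V hT]
      simpa using h)
    refine le_trans (ENNReal.ofReal_le_ofReal (le_of_eq ?_)) h1
    simp [div_eq_mul_inv]
  · refine le_trans (ENNReal.ofReal_le_ofReal ?_) (ENNReal.le_tsum d.one)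
    have h1 : ((1 : ℝ) / 3) ^ p ≤ 1 := Real.rpow_le_one (by norm_num) (by norm_num) hp.le
    simp only [Domain.one, Int.cast_one, abs_one, Real.one_rpow, one_mul]
    change _ ≤ avgProb V d.one T
    linarith

/-- Solves the self-referential inequality: multiply by `X ^ p` and take the root of order `p + 1`.
Having the same `c` in both places makes that root exactly `1 / c`. -/
theorem rpow_mul_rpow_le_of_mul_le {p c X g m : ℝ} (hp : 0 < p) (hc : 0 < c) (hX : 0 < X)
    (hg : 0 < g) (hm : 0 < m) (h : (m ^ 2 * g / (c * X)) ^ p * m / c ≤ X) :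
    (1 / c) * g ^ (p / (p + 1)) * m ^ ((1 + 2 * p) / (p + 1)) ≤ X := by
  have hp1 : 0 < p + 1 := by linarith
  have hpow : (1 / c) ^ (p + 1) * g ^ p * m ^ (1 + 2 * p) ≤ X ^ (p + 1) := by
    rw [Real.div_rpow (by positivity) (by positivity), Real.mul_rpow (by positivity) hg.le,
      Real.mul_rpow hc.le hX.le, ← Real.rpow_natCast, ← Real.rpow_mul hm.le] at h
    rw [Real.div_rpow zero_le_one hc.le, Real.one_rpow, Real.rpow_add_one hc.ne',
      Real.rpow_add_one hX.ne', Real.rpow_add hm, Real.rpow_one]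
    have hXp : 0 < X ^ p := by positivity
    have hcp : 0 < c ^ p := by positivity
    push_cast at h
    calc 1 / (c ^ p * c) * g ^ p * (m * m ^ (2 * p))
        = X ^ p * (m ^ (2 * p) * g ^ p / (c ^ p * X ^ p) * m / c) := by field_simp
      _ ≤ X ^ p * X := by gcongr
  rw [← Real.rpow_le_rpow_iff (by positivity) hX.le hp1]
  rw [Real.mul_rpow (by positivity) (by positivity), Real.mul_rpow (by positivity) (by positivity),
    ← Real.rpow_mul hg.le, ← Real.rpow_mul hm.le, div_mul_cancel₀ _ hp1.ne',
    div_mul_cancel₀ _ hp1.ne']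
  exact hpow

theorem moment_lower_bound {p : ℝ} (hp : 0 < p) {T : ℝ} (hT : 0 < T) {A : Set ℝ}
    (hA : MeasurableSet A) (hμA : 0 < spectralMeasure V A) {g : ℝ} (hg : 0 < g)
    (h : ENNReal.ofReal (g * energyIntegral V (Metric.thickening (2 * (1 / T)) A) (1 / T)) ≤
      moment V p T) :
    ENNReal.ofReal (1 / (32 * 3 ^ p) * g ^ (p / (p + 1)) *
      (spectralMeasure V).real A ^ ((1 + 2 * p) / (p + 1))) ≤ moment V p T := by
  have := (spectralMeasure_spec V).1
  have hε : 0 < 1 / T := by positivity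
  set m := (spectralMeasure V).real A with hm_def
  have hm : 0 < m := ENNReal.toReal_pos hμA.ne' (measure_ne_top _ _)
  have hm1 : m ≤ 1 := measureReal_le_one
  by_cases htop : moment V p T = ⊤
  · rw [htop]; exact le_top
  set X := (moment V p T).toReal with hX_def
  have hXof : moment V p T = ENNReal.ofReal X := (ENNReal.ofReal_toReal htop).symm
  have hX0 : 0 ≤ X := ENNReal.toReal_nonneg
  have h3 : (1 : ℝ) ≤ 3 ^ p := Real.one_le_rpow (by norm_num) hp.le
  have hX1 : (1 / 3) ^ p / 4 ≤ X := by
    have := moment_lower_bound_const V hp hT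
    rwa [hXof, ENNReal.ofReal_le_ofReal_iff hX0] at this
  have hX : 0 < X := lt_of_lt_of_le (by positivity) hX1
  rw [hXof, ENNReal.ofReal_le_ofReal_iff hX0] at h
  rw [hXof]
  refine ENNReal.ofReal_le_ofReal (rpow_mul_rpow_le_of_mul_le hp (by positivity) hX hg hm ?_)
  -- Chosen so that `8 ν (X / g) = m² / 4`, the threshold of the kernel criterion; `X / g` bounds
  -- the energy integral by hypothesis.
  set ν := m ^ 2 * g / (32 * X) with hν_def
  have hν0 : 0 < ν := by positivity
  have hfac : (m ^ 2 * g / (32 * 3 ^ p * X)) ^ p * m / (32 * 3 ^ p) ≤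
      ν ^ p * ((1 / 3) ^ p * (m / 4)) := by
    have h1 : m ^ 2 * g / (32 * 3 ^ p * X) ≤ ν := by
      refine div_le_div_of_nonneg_left (by positivity) (by positivity) ?_
      nlinarith
    have h2 : (m ^ 2 * g / (32 * 3 ^ p * X)) ^ p ≤ ν ^ p :=
      Real.rpow_le_rpow (by positivity) h1 hp.le
    rw [mul_div_assoc]
    refine mul_le_mul h2 ?_ (by positivity) (by positivity)
    rw [Real.div_rpow zero_le_one (by norm_num), Real.one_rpow, div_mul_div_comm, one_mul]
    refine div_le_div_of_nonneg_left hm.le (by positivity) ?_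
    nlinarith
  refine hfac.trans ?_
  rcases le_or_gt 1 ν with hν | hν
  · have hJ := integral_kernel_le hε (spectralMeasure V) hA
    simp only [← im_borelTransform V hε] at hJ
    change _ ≤ 8 * energyIntegral V _ _ at hJ
    have h4 := le_moment_of_kernel V hp hT hA hm hν (by
      refine (mul_le_mul_of_nonneg_left hJ hν0.le).trans ?_
      have h5 : ν * (8 * energyIntegral V (Metric.thickening (2 * (1 / T)) A) (1 / T)) =
        m ^ 2 / (4 * X) *
          (g * energyIntegral V (Metric.thickening (2 * (1 / T)) A) (1 / T)) := by
        rw [hν_def]; field_simp; ring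
      rw [h5]
      calc _ ≤ m ^ 2 / (4 * X) * X := by gcongr
        _ = m ^ 2 / 4 := by field_simp)
    rw [hXof, ENNReal.ofReal_le_ofReal_iff hX0, Real.div_rpow hν0.le (by norm_num)] at h4
    rw [Real.div_rpow zero_le_one (by norm_num), Real.one_rpow]
    refine le_trans (le_of_eq ?_) h4
    ring
  -- For `ν < 1` the target is at most `(1 / 3) ^ p / 4`, since also `m ≤ 1`, and the constant bound
  -- applies.
  · have h4 : ν ^ p ≤ 1 := Real.rpow_le_one hν0.le hν.le hp.le
    refine le_trans ?_ hX1
    calc ν ^ p * ((1 / 3) ^ p * (m / 4)) ≤ 1 * ((1 / 3) ^ p * (1 / 4)) := by gcongr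
      _ = _ := by ring

end Schrodinger

theorem theorem2 (p : ℝ) (hp : 0 < p) :
    (∃ C : ℝ, 0 < C ∧ ∀ (d : Schrodinger.Domain) (V : d.sites → ℝ) (A : ℝ → Set ℝ) (g : ℝ → ℝ)
      (T : ℝ), 0 < T → MeasurableSet (A T) → 0 < Schrodinger.spectralMeasure V (A T) → 0 < g T →
      ENNReal.ofReal (g T * Schrodinger.energyIntegral V (Metric.thickening (2 * (1 / T)) (A T))
        (1 / T)) ≤ Schrodinger.moment V p T →
      ENNReal.ofReal (C * g T ^ (p / (p + 1)) *
        (Schrodinger.spectralMeasure V).real (A T) ^ ((1 + 2 * p) / (p + 1))) ≤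
          Schrodinger.moment V p T) ∧
    (∀ (d : Schrodinger.Domain) (V : d.sites → ℝ) (A : Set ℝ), MeasurableSet A →
      0 < Schrodinger.spectralMeasure V A →
      ∃ C : ℝ, 0 < C ∧ ∀ (g : ℝ → ℝ) (T : ℝ), 0 < T → 0 < g T →
        ENNReal.ofReal (g T * Schrodinger.energyIntegral V (Metric.thickening (2 * (1 / T)) A)
          (1 / T)) ≤ Schrodinger.moment V p T →
        ENNReal.ofReal (C * g T ^ (p / (p + 1))) ≤ Schrodinger.moment V p T) := by
  refine ⟨⟨1 / (32 * 3 ^ p), by positivity, ?_⟩, ?_⟩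
  · intro d V A g T hT hA hμA hg h
    exact Schrodinger.moment_lower_bound V hp hT hA hμA hg h
  · intro d V A hA hμA
    have := (Schrodinger.spectralMeasure_spec V).1
    have hm : 0 < (Schrodinger.spectralMeasure V).real A :=
      ENNReal.toReal_pos hμA.ne' (measure_ne_top _ _)
    refine ⟨1 / (32 * 3 ^ p) * (Schrodinger.spectralMeasure V).real A ^ ((1 + 2 * p) / (p + 1)),
      by positivity, ?_⟩
    intro g T hT hg h
    rw [mul_right_comm]
    exact Schrodinger.moment_lower_bound V hp hT hA hμA hg h
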